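/- There is an absolute constant $C$ such that the following holds for all integers $\Delta\ge 0$ and $n\ge 2$. Let $\mathcal P\subseteq\mathbb R^d$ be a polytope (the convex hull of finitely many points) whose affine hull has dimension $n$. A slack matrix of $\mathcal P$ is a matrix $\mathbf S$ with rows indexed by the facets of $\mathcal P$ and columns indexed by its vertices, obtained by choosing for every facet $f$ a halfspace $\{x : a_f^\top x\le b_f\}$ that contains $\mathcal P$ and satisfies $f=\{x\in\mathcal P : a_f^\top x=b_f\}$, and setting $\mathbf S_{f,v}=b_f-a_f^\top v$. The extension complexity $\mathrm{xc}(\mathcal P)$ is the minimum number of facets of a polytope $\mathcal Q\subseteq\mathbb R^m$, with $m$ arbitrary, such that $\pi(\mathcal Q)=\mathcal P$ for some linear map $\pi:\mathbb R^m\to\mathbb R^d$. If $\mathcal P$ has a slack matrix all of whose entries are integers in $\{0,1,\dots,\Delta\}$, then $$\mathrm{xc}(\mathcal P)\le \exp\!\big(\max\{\Delta,2\}^{C\Delta}\cdot\sqrt n\cdot\log n\big).$$ -/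

import Mathlib

/-- A polytope in `ℝ^d`: the convex hull of finitely many points. -/
def IsPolytope {d : ℕ} (P : Set (Fin d → ℝ)) : Prop :=
  ∃ s : Set (Fin d → ℝ), s.Finite ∧ P = convexHull ℝ s

/-- The dimension of (the affine hull of) a nonempty subset of `ℝ^d`. -/
noncomputable def affDim {d : ℕ} (P : Set (Fin d → ℝ)) : ℕ :=
  Module.finrank ℝ (vectorSpan ℝ P)

/-- `F` is a facet of `P`: a nonempty face of dimension one less than that of `P`
(the faces of a polytope are its exposed faces). -/
def IsFacet {d : ℕ} (P F : Set (Fin d → ℝ)) : Prop :=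
  F.Nonempty ∧ IsExposed ℝ P F ∧ affDim F + 1 = affDim P

/-- The extension complexity of `P`: the least number of facets of a polytope `Q`, in a space of
any dimension, that a linear map carries onto `P`. -/
noncomputable def extensionComplexity {d : ℕ} (P : Set (Fin d → ℝ)) : ℕ∞ :=
  sInf {k : ℕ∞ | ∃ (m : ℕ) (Q : Set (Fin m → ℝ)) (π : (Fin m → ℝ) →ₗ[ℝ] (Fin d → ℝ)),
    IsPolytope Q ∧ π '' Q = P ∧ k = {F | IsFacet Q F}.encard}

/-- The halfspace `a ⬝ x ≤ b` contains `P` and defines its face `F`. -/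
def DefinesFace {d : ℕ} (P F : Set (Fin d → ℝ)) (a : Fin d → ℝ) (b : ℝ) : Prop :=
  (∀ x ∈ P, a ⬝ᵥ x ≤ b) ∧ F = {x ∈ P | a ⬝ᵥ x = b}

/-- `S`, with rows indexed by the facets and columns by the vertices of `P`, is a slack matrix
of `P`: its entries are the slacks `b_f - a_f ⬝ v` for some choice of one defining halfspace
`a_f ⬝ x ≤ b_f` for each facet `f`. -/
def IsSlackMatrix {d : ℕ} (P : Set (Fin d → ℝ))
    (S : Matrix {F : Set (Fin d → ℝ) // IsFacet P F} (P.extremePoints ℝ) ℝ) : Prop :=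
  ∃ (a : {F : Set (Fin d → ℝ) // IsFacet P F} → (Fin d → ℝ))
    (b : {F : Set (Fin d → ℝ) // IsFacet P F} → ℝ),
    (∀ f, DefinesFace P f.1 (a f) (b f)) ∧
    ∀ f v, S f v = b f - a f ⬝ᵥ v.1

/-! By Yannakakis, a nonnegative factorization of a slack matrix with `N` terms gives an extended
formulation with at most `N` facets (`extensionComplexity_le_of_nonnegRankLE`). A slack matrix is
affine in the vertex, so its rank is at most `n + 1`. It therefore suffices to bound the nonnegative
rank of a matrix of rank at most `r` with entries in `{0, …, Δ}` by `exp (O(Δ ^ 3 * √r * log r))`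
(`nonnegRankBound_floor_exp`).

The heart is that such a matrix `A` has a monochromatic rectangle of density `exp (-O(Δ ^ 3 * √r *
log r))`. A D-optimal design writes `A i j` as an inner product of vectors of norms at most `√r` and
`Δ`. After rescaling, random Fourier features turn `exp (A i j / (Δ * √r))`, up to scaling and
shift, into a mixture of rectangles. Powers of this kernel are again mixtures, since rectangles
intersect in rectangles. A suitable power `T` makes a single value `v` dominate the weighted count
of entries, so some large rectangle is almost entirely `v`. Low rank then allows the exceptions to
be removed.

Rectangles are turned into a factorization as in Nisan and Wigderson. Next to a constant block, one
of the two off-diagonal blocks has about half the rank and is treated by induction on the rank,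
while the remaining matrix has lost a definite fraction of its entries. Since the rank drops
geometrically, the logarithms of the costs sum to a constant multiple of the first one. -/

/-- The polyhedron cut out of an affine subspace by finitely many homogeneous inequalities. -/
def polyhedron {m : ℕ} {ι : Type} (L : AffineSubspace ℝ (Fin m → ℝ))
    (y : ι → (Fin m → ℝ) →ₗ[ℝ] ℝ) : Set (Fin m → ℝ) :=
  {z | z ∈ L ∧ ∀ k, 0 ≤ y k z}

/-! ### Polyhedra given by inequalities: compactness, extreme sets and the number of facets. -/

section Polyhedron

open Filter Topology

variable {m : ℕ} {ι : Type} {L : AffineSubspace ℝ (Fin m → ℝ)} {y : ι → (Fin m → ℝ) →ₗ[ℝ] ℝ}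

theorem convex_polyhedron : Convex ℝ (polyhedron L y) := by
  intro a ha b hb s t hs ht hst
  refine ⟨L.convex ha.1 hb.1 hs ht hst, fun k => ?_⟩
  have h1 := ha.2 k
  have h2 := hb.2 k
  simp only [map_add, map_smul, smul_eq_mul]
  positivity

/-- A segment of a polyhedron can be prolonged beyond an endpoint all of whose tight constraints
are tight at the other endpoint. -/
theorem exists_prolongation [Finite ι] {z z' : Fin m → ℝ} (hz : z ∈ polyhedron L y)
    (hz' : z' ∈ polyhedron L y) (h : ∀ k, y k z = 0 → y k z' = 0) :
    ∃ ε : ℝ, 0 < ε ∧ z + ε • (z - z') ∈ polyhedron L y := by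
  have key : ∀ᶠ ε : ℝ in 𝓝[>] 0, ∀ k, 0 ≤ y k (z + ε • (z - z')) := by
    rw [eventually_all]
    intro k
    rcases (hz.2 k).eq_or_lt with h0 | h0
    · have h1 := h k h0.symm
      refine Eventually.of_forall fun ε => ?_
      simp [← h0, h1]
    · have hc : Continuous fun ε : ℝ => y k z + ε * (y k z - y k z') := by fun_prop
      have h1 : ∀ᶠ ε : ℝ in 𝓝 0, 0 < y k z + ε * (y k z - y k z') :=
        continuousAt_const.eventually_lt hc.continuousAt (by simpa using h0)
      filter_upwards [nhdsWithin_le_nhds h1] with ε hε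
      simpa using hε.le
  obtain ⟨ε, hε, hpos⟩ := (key.and self_mem_nhdsWithin).exists
  refine ⟨ε, hpos, ?_, hε⟩
  have := L.smul_vsub_vadd_mem ε hz.1 hz'.1 hz.1
  simpa [add_comm] using this

/-- `z` lies strictly between `z'` and the prolonged point, so extremality puts `z'` in `F`. Hence
an extreme point is determined by its set of tight constraints. -/
theorem mem_of_isExtreme_polyhedron [Finite ι] {F : Set (Fin m → ℝ)}
    (hF : IsExtreme ℝ (polyhedron L y) F) {z z' : Fin m → ℝ} (hz : z ∈ F)
    (hz' : z' ∈ polyhedron L y) (h : ∀ k, y k z = 0 → y k z' = 0) : z' ∈ F := by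
  obtain ⟨ε, hε, hmem⟩ := exists_prolongation (hF.1 hz) hz' h
  refine hF.2 hz' hmem hz ?_
  refine ⟨ε / (1 + ε), 1 / (1 + ε), by positivity, by positivity, by field_simp; ring, ?_⟩
  ext i
  simp
  field_simp
  ring

theorem isPolytope_polyhedron [Finite ι] (hc : IsCompact (polyhedron L y)) :
    IsPolytope (polyhedron L y) := by
  have hfin : ((polyhedron L y).extremePoints ℝ).Finite := by
    refine Set.Finite.of_finite_image (f := fun z => {k | y k z = 0}) (Set.toFinite _) ?_
    intro z hz z' hz' h
    have := mem_of_isExtreme_polyhedron (isExtreme_singleton.2 hz) rfl hz'.1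
      (fun k hk => (Set.ext_iff.1 h k).1 hk)
    exact (Set.mem_singleton_iff.1 this).symm
  refine ⟨_, hfin, ?_⟩
  rw [← (hfin.isClosed_convexHull ℝ).closure_eq,
    closure_convexHull_extremePoints hc convex_polyhedron]

/-- A point `z` of `F` with the fewest tight constraints plays the role of a relative interior
point. A constraint tight at `z` but not on the whole polyhedron cuts out a proper subset `G`
containing `F`. The dimension leaves no room between them, so both have the same direction, and the
functional exposing `F` is constant on `G`. -/
theorem exists_isFacet_eq [Finite ι] {F : Set (Fin m → ℝ)} (hF : IsFacet (polyhedron L y) F) :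
    ∃ k, F = {z ∈ polyhedron L y | y k z = 0} := by
  obtain ⟨hne, hexp, hdim⟩ := hF
  have hext := hexp.isExtreme
  have hconv := hexp.convex convex_polyhedron
  obtain ⟨l, hl⟩ := hexp hne
  -- a point of `F` at which as few constraints as possible are tight
  obtain ⟨z, hzF, hz⟩ : ∃ z ∈ F, ∀ z' ∈ F, ∀ k, y k z = 0 → y k z' = 0 := by
    have hex : ∃ N, ∃ z ∈ F, {k | y k z = 0}.ncard = N := ⟨_, hne.some, hne.some_mem, rfl⟩
    classical
    obtain ⟨z, hzF, hN⟩ := Nat.find_spec hex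
    refine ⟨z, hzF, fun z' hz' k hk => ?_⟩
    by_contra hk'
    let w := (1 / 2 : ℝ) • z + (1 / 2 : ℝ) • z'
    have hw : w ∈ F := hconv hzF hz' (by norm_num) (by norm_num) (by norm_num)
    have hyw : ∀ j, y j w = (1 / 2 : ℝ) * y j z + (1 / 2 : ℝ) * y j z' := fun j => by simp [w]
    refine Nat.find_min hex ?_ ⟨w, hw, rfl⟩
    rw [← hN]
    refine Set.ncard_lt_ncard ⟨fun j hj => ?_, fun hsub => ?_⟩ (Set.toFinite _)
    · have h1 := (hext.1 hzF).2 j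
      have h2 := (hext.1 hz').2 j
      have h3 : y j w = 0 := hj
      rw [hyw] at h3
      show y j z = 0
      linarith
    · have h3 : y k w = 0 := hsub hk
      rw [hyw, hk] at h3
      exact hk' (by linarith)
  have hFsub := hext.1
  -- some constraint is tight at `z` but not on the whole polyhedron
  obtain ⟨k, hk, q, hq, hkq⟩ : ∃ k, y k z = 0 ∧ ∃ q ∈ polyhedron L y, y k q ≠ 0 := by
    by_contra! hcon
    have : F = polyhedron L y := hFsub.antisymm fun q hq =>
      mem_of_isExtreme_polyhedron hext hzF hq fun k hk => hcon k hk q hq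
    rw [this] at hdim
    omega
  set G := {z ∈ polyhedron L y | y k z = 0} with hG
  have hFG : F ⊆ G := fun z' hz' => ⟨hFsub hz', hz z' hz' k hk⟩
  have hGQ : G ⊆ polyhedron L y := fun z hz => hz.1
  have hlt : vectorSpan ℝ G < vectorSpan ℝ (polyhedron L y) := by
    refine lt_of_le_of_ne (vectorSpan_mono ℝ hGQ) fun heq => hkq ?_
    have h1 : vectorSpan ℝ G ≤ LinearMap.ker (y k) := by
      rw [vectorSpan, Submodule.span_le]
      rintro _ ⟨a, ha, b, hb, rfl⟩
      simp [ha.2, hb.2]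
    have h2 : q - z ∈ vectorSpan ℝ (polyhedron L y) := vsub_mem_vectorSpan ℝ hq (hFsub hzF)
    rw [← heq] at h2
    simpa [hk] using h1 h2
  have hfr := Submodule.finrank_lt_finrank_of_lt hlt
  have hspan : vectorSpan ℝ F = vectorSpan ℝ G := by
    refine Submodule.eq_of_le_of_finrank_le (vectorSpan_mono ℝ hFG) ?_
    unfold affDim at hdim
    omega
  refine ⟨k, hFG.antisymm fun g hg => ?_⟩
  have h1 : vectorSpan ℝ F ≤ LinearMap.ker l.toLinearMap := by
    rw [vectorSpan, Submodule.span_le]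
    rintro _ ⟨a, ha, b, hb, rfl⟩
    have ha' := ha
    have hb' := hb
    rw [hl] at ha' hb'
    simp [le_antisymm (hb'.2 a (hFsub ha)) (ha'.2 b (hFsub hb))]
  have h2 : g - z ∈ vectorSpan ℝ G := vsub_mem_vectorSpan ℝ hg (hFG hzF)
  rw [← hspan] at h2
  have h3 : l g = l z := by simpa [sub_eq_zero] using h1 h2
  rw [hl] at hzF ⊢
  exact ⟨hGQ hg, fun w hw => h3 ▸ hzF.2 w hw⟩

theorem encard_isFacet_polyhedron_le [Finite ι] :
    {F | IsFacet (polyhedron L y) F}.encard ≤ Nat.card ι := by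
  have hsub : {F | IsFacet (polyhedron L y) F} ⊆
      Set.range fun k => {z ∈ polyhedron L y | y k z = 0} := fun F hF => by
    obtain ⟨k, hk⟩ := exists_isFacet_eq hF
    exact ⟨k, hk.symm⟩
  refine (Set.encard_le_encard hsub).trans ?_
  rw [← Set.image_univ]
  refine (Set.encard_image_le _ _).trans ?_
  rw [Set.encard_univ, ENat.card_eq_coe_natCard]

end Polyhedron

/-! ### The facet description of a polytope -/

section FacetDescription

variable {d : ℕ} {P : Set (Fin d → ℝ)}

theorem IsPolytope.isCompact (hP : IsPolytope P) : IsCompact P := by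
  obtain ⟨s, hs, rfl⟩ := hP
  exact hs.isCompact_convexHull ℝ

theorem IsPolytope.convex (hP : IsPolytope P) : Convex ℝ P := by
  obtain ⟨s, hs, rfl⟩ := hP
  exact convex_convexHull ℝ s

theorem IsPolytope.finite_extremePoints (hP : IsPolytope P) : (P.extremePoints ℝ).Finite := by
  obtain ⟨s, hs, rfl⟩ := hP
  exact hs.subset extremePoints_convexHull_subset

theorem IsPolytope.convexHull_extremePoints (hP : IsPolytope P) :
    convexHull ℝ (P.extremePoints ℝ) = P := by
  rw [← (hP.finite_extremePoints.isClosed_convexHull ℝ).closure_eq,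
    closure_convexHull_extremePoints hP.isCompact hP.convex]

theorem IsPolytope.forall_le_of_extremePoints (hP : IsPolytope P) {a : Fin d → ℝ} {b : ℝ}
    (h : ∀ v ∈ P.extremePoints ℝ, a ⬝ᵥ v ≤ b) : ∀ x ∈ P, a ⬝ᵥ x ≤ b := by
  have hconv : Convex ℝ {x : Fin d → ℝ | a ⬝ᵥ x ≤ b} :=
    convex_halfSpace_le (f := fun x => a ⬝ᵥ x)
      ⟨fun x y => dotProduct_add a x y, fun c x => dotProduct_smul c a x⟩ b
  have := convexHull_min h hconv
  rwa [hP.convexHull_extremePoints] at this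

theorem exists_dotProduct_eq_apply (f : (Fin d → ℝ) →ₗ[ℝ] ℝ) :
    ∃ g : Fin d → ℝ, ∀ v, g ⬝ᵥ v = f v := by
  refine ⟨fun i => f (Pi.single i 1), fun v => ?_⟩
  rw [LinearMap.pi_apply_eq_sum_univ f v]
  simp only [dotProduct, smul_eq_mul]
  exact Finset.sum_congr rfl fun i _ => by
    rw [mul_comm]
    congr 2
    ext j
    simp [Pi.single_apply, eq_comm]

theorem exists_dotProduct_eq_zero_of_lt {V W : Submodule ℝ (Fin d → ℝ)} (h : V < W) :
    ∃ g : Fin d → ℝ, (∀ v ∈ V, g ⬝ᵥ v = 0) ∧ ∃ w ∈ W, g ⬝ᵥ w ≠ 0 := by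
  obtain ⟨w, hw, hwV⟩ := SetLike.exists_of_lt h
  obtain ⟨f, hf, hfV⟩ := Submodule.exists_le_ker_of_notMem hwV
  obtain ⟨g, hg⟩ := exists_dotProduct_eq_apply f
  refine ⟨g, fun v hv => ?_, w, hw, ?_⟩
  · rw [hg]
    exact hfV hv
  · rwa [hg]

theorem dotProduct_eq_zero_of_mem_vectorSpan {F : Set (Fin d → ℝ)} {a : Fin d → ℝ} {b : ℝ}
    (h : ∀ x ∈ F, a ⬝ᵥ x = b) {v : Fin d → ℝ} (hv : v ∈ vectorSpan ℝ F) : a ⬝ᵥ v = 0 := by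
  have h1 : vectorSpan ℝ F ≤ LinearMap.ker (dotProductBilin ℝ ℝ a) := by
    rw [vectorSpan, Submodule.span_le]
    rintro _ ⟨x, hx, y, hy, rfl⟩
    simp [h x hx, h y hy, dotProduct_sub]
  simpa using h1 hv

/-- The tilting step: a separating valid inequality whose face has codimension at least two can be
replaced by one with a face of larger dimension. -/
theorem exists_larger_face (hP : IsPolytope P) {x : Fin d → ℝ} (hx : x ∈ affineSpan ℝ P)
    {a : Fin d → ℝ} {b : ℝ} (hab : ∀ p ∈ P, a ⬝ᵥ p ≤ b) (hne : ∃ p ∈ P, a ⬝ᵥ p = b)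
    (hxb : b < a ⬝ᵥ x) (hdim : affDim {p ∈ P | a ⬝ᵥ p = b} + 1 < affDim P) :
    ∃ (a' : Fin d → ℝ) (b' : ℝ), (∀ p ∈ P, a' ⬝ᵥ p ≤ b') ∧ (∃ p ∈ P, a' ⬝ᵥ p = b') ∧
      b' < a' ⬝ᵥ x ∧ affDim {p ∈ P | a ⬝ᵥ p = b} < affDim {p ∈ P | a' ⬝ᵥ p = b'} := by
  set F := {p ∈ P | a ⬝ᵥ p = b} with hF
  obtain ⟨q, hqP, hq⟩ := hne
  have hqF : q ∈ F := ⟨hqP, hq⟩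
  have hFP : F ⊆ P := fun p hp => hp.1
  have hxq : x - q ∈ vectorSpan ℝ P := by
    rw [← direction_affineSpan]
    exact AffineSubspace.vsub_mem_direction hx (subset_affineSpan ℝ P hqP)
  -- Codimension at least two leaves a functional `g` that is constant on `F ∪ {x}` but not on `P`.
  -- Tilting along `g` keeps `F` tight and does not change the violation at `x`.
  have hlt : vectorSpan ℝ F ⊔ Submodule.span ℝ {x - q} < vectorSpan ℝ P := by
    refine lt_of_le_of_ne (sup_le (vectorSpan_mono ℝ hFP) ?_) fun heq => ?_
    · rw [Submodule.span_singleton_le_iff_mem]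
      exact hxq
    · have h1 := Submodule.finrank_add_le_finrank_add_finrank (vectorSpan ℝ F)
        (Submodule.span ℝ {x - q})
      have h2 := finrank_span_le_card (R := ℝ) ({x - q} : Set (Fin d → ℝ))
      rw [heq] at h1
      simp only [Set.toFinset_singleton, Finset.card_singleton] at h2
      unfold affDim at hdim
      omega
  obtain ⟨g, hg, hgP⟩ : ∃ g : Fin d → ℝ, (∀ v ∈ vectorSpan ℝ F ⊔ Submodule.span ℝ {x - q},
      g ⬝ᵥ v = 0) ∧ ∃ p ∈ P, g ⬝ᵥ q < g ⬝ᵥ p := by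
    obtain ⟨g, hg, w, hw, hgw⟩ := exists_dotProduct_eq_zero_of_lt hlt
    obtain ⟨p, hp, hpq⟩ : ∃ p ∈ P, g ⬝ᵥ p ≠ g ⬝ᵥ q := by
      by_contra! hcon
      exact hgw (dotProduct_eq_zero_of_mem_vectorSpan hcon hw)
    rcases hpq.lt_or_gt with h | h
    · exact ⟨-g, fun v hv => by simp [hg v hv], p, hp, by simpa using h⟩
    · exact ⟨g, hg, p, hp, h⟩
  have hgF : ∀ p ∈ F, g ⬝ᵥ p = g ⬝ᵥ q := fun p hp => by
    have := hg (p - q) (Submodule.mem_sup_left (vsub_mem_vectorSpan ℝ hp hqF))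
    rwa [dotProduct_sub, sub_eq_zero] at this
  have hgx : g ⬝ᵥ x = g ⬝ᵥ q := by
    have := hg (x - q) (Submodule.mem_sup_right (Submodule.mem_span_singleton_self _))
    rwa [dotProduct_sub, sub_eq_zero] at this
  -- Ratio test: the minimum is the first tilt at which a vertex outside `F` becomes tight.
  obtain ⟨v, ⟨hv, hgv⟩, hmin⟩ := Set.exists_min_image
    {v ∈ P.extremePoints ℝ | g ⬝ᵥ q < g ⬝ᵥ v} (fun v => (b - a ⬝ᵥ v) / (g ⬝ᵥ v - g ⬝ᵥ q))
    (hP.finite_extremePoints.subset fun v hv => hv.1) (by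
      by_contra hcon
      obtain ⟨p, hp, hpq⟩ := hgP
      refine hpq.not_ge (hP.forall_le_of_extremePoints (fun v hv => ?_) p hp)
      by_contra! h
      exact hcon ⟨v, hv, h⟩)
  have hvP : v ∈ P := hv.1
  set t := (b - a ⬝ᵥ v) / (g ⬝ᵥ v - g ⬝ᵥ q) with ht
  have ht0 : 0 ≤ t := div_nonneg (sub_nonneg.2 (hab v hvP)) (sub_pos.2 hgv).le
  have hvt : (a + t • g) ⬝ᵥ v = b + t * (g ⬝ᵥ q) := by
    have : t * (g ⬝ᵥ v - g ⬝ᵥ q) = b - a ⬝ᵥ v := div_mul_cancel₀ _ (sub_pos.2 hgv).ne'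
    simp only [add_dotProduct, smul_dotProduct, smul_eq_mul]
    linarith
  refine ⟨a + t • g, b + t * (g ⬝ᵥ q), hP.forall_le_of_extremePoints fun u hu => ?_,
    ⟨v, hvP, hvt⟩, ?_, ?_⟩
  · simp only [add_dotProduct, smul_dotProduct, smul_eq_mul]
    rcases le_or_gt (g ⬝ᵥ u) (g ⬝ᵥ q) with h | h
    · have := mul_le_mul_of_nonneg_left h ht0
      linarith [hab u hu.1]
    · have := hmin u ⟨hu, h⟩
      rw [le_div_iff₀ (sub_pos.2 h)] at this
      linarith
  · simp only [add_dotProduct, smul_dotProduct, smul_eq_mul, hgx]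
    linarith
  · refine Submodule.finrank_lt_finrank_of_lt (lt_of_le_of_ne (vectorSpan_mono ℝ fun p hp => ?_)
      fun heq => ?_)
    · refine ⟨hp.1, ?_⟩
      simp only [add_dotProduct, smul_dotProduct, smul_eq_mul, hgF p hp, hp.2]
    · have h1 : v - q ∈ vectorSpan ℝ F := by
        rw [heq]
        refine vsub_mem_vectorSpan ℝ ⟨hvP, hvt⟩ ⟨hqP, ?_⟩
        simp only [add_dotProduct, smul_dotProduct, smul_eq_mul, hq]
      have := dotProduct_eq_zero_of_mem_vectorSpan hgF h1
      rw [dotProduct_sub] at this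
      linarith

/-- A polytope is cut out of its affine hull by any choice of facet-defining inequalities. -/
theorem IsPolytope.mem_of_facet_inequalities (hP : IsPolytope P) (hPne : P.Nonempty)
    {x : Fin d → ℝ} (hx : x ∈ affineSpan ℝ P)
    (h : ∀ F, IsFacet P F → ∃ a b, DefinesFace P F a b ∧ a ⬝ᵥ x ≤ b) : x ∈ P := by
  by_contra hxP
  -- Among the supporting inequalities violated at `x`, one whose face has largest dimension cannot
  -- be tilted further, so its face is a facet.
  let D : Set ℕ := {k | ∃ (a : Fin d → ℝ) (b : ℝ), (∀ p ∈ P, a ⬝ᵥ p ≤ b) ∧ (∃ p ∈ P, a ⬝ᵥ p = b) ∧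
    b < a ⬝ᵥ x ∧ affDim {p ∈ P | a ⬝ᵥ p = b} = k}
  have hDne : D.Nonempty := by
    obtain ⟨f, u, hf, hu⟩ := geometric_hahn_banach_closed_point hP.convex hP.isCompact.isClosed hxP
    obtain ⟨p, hp, hmax⟩ := hP.isCompact.exists_isMaxOn hPne f.continuous.continuousOn
    obtain ⟨a, ha⟩ := exists_dotProduct_eq_apply f.toLinearMap
    refine ⟨_, a, f p, fun q hq => ?_, ⟨p, hp, ha p⟩, ?_, rfl⟩
    · rw [ha]
      exact hmax hq
    · rw [ha]
      exact (hf p hp).trans hu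
  have hDb : BddAbove D := by
    refine ⟨affDim P, ?_⟩
    rintro _ ⟨a, b, -, -, -, rfl⟩
    exact Submodule.finrank_mono (vectorSpan_mono ℝ fun p hp => hp.1)
  obtain ⟨a, b, hab, hne, hxb, hk⟩ := Nat.sSup_mem hDne hDb
  have hnot : ¬ affDim {p ∈ P | a ⬝ᵥ p = b} + 1 < affDim P := fun hlt => by
    obtain ⟨a', b', h1, h2, h3, h4⟩ := exists_larger_face hP hx hab hne hxb hlt
    have := le_csSup hDb ⟨a', b', h1, h2, h3, rfl⟩
    omega
  set F := {p ∈ P | a ⬝ᵥ p = b} with hF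
  obtain ⟨q, hqP, hq⟩ := hne
  have hqF : q ∈ F := ⟨hqP, hq⟩
  have hFP : F ⊆ P := fun p hp => hp.1
  have hxq : x - q ∈ vectorSpan ℝ P := by
    rw [← direction_affineSpan]
    exact AffineSubspace.vsub_mem_direction hx (subset_affineSpan ℝ P hqP)
  have hlt : affDim F < affDim P := by
    refine Submodule.finrank_lt_finrank_of_lt (lt_of_le_of_ne (vectorSpan_mono ℝ hFP)
      fun heq => ?_)
    rw [← heq] at hxq
    have := dotProduct_eq_zero_of_mem_vectorSpan (fun p hp => (hp : p ∈ F).2) hxq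
    rw [dotProduct_sub] at this
    linarith
  have hdim : affDim F + 1 = affDim P := by omega
  have hfacet : IsFacet P F := by
    refine ⟨⟨q, hqF⟩, fun _ => ⟨LinearMap.toContinuousLinearMap (dotProductBilin ℝ ℝ a), ?_⟩, hdim⟩
    ext p
    simp only [hF, Set.mem_ofPred_eq, LinearMap.coe_toContinuousLinearMap', dotProductBilin_apply_apply]
    refine and_congr_right fun hp => ⟨fun h y hy => h ▸ hab y hy, fun h => ?_⟩
    exact le_antisymm (hab p hp) (hq ▸ h q hqP)
  obtain ⟨a', b', ⟨hab', hF'⟩, hxb'⟩ := h F hfacet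
  obtain ⟨p, hpP, hpF⟩ : ∃ p ∈ P, p ∉ F := by
    by_contra! hcon
    rw [hFP.antisymm hcon] at hlt
    exact lt_irrefl _ hlt
  have hp1 : a ⬝ᵥ p < b := lt_of_le_of_ne (hab p hpP) fun h => hpF ⟨hpP, h⟩
  have hp2 : a' ⬝ᵥ p < b' := lt_of_le_of_ne (hab' p hpP) fun h => hpF (hF' ▸ ⟨hpP, h⟩)
  have hF'2 : ∀ r ∈ F, a' ⬝ᵥ r = b' := fun r hr => by
    rw [hF'] at hr
    exact hr.2
  -- the combination of the two inequalities that is tight at `p` is tight on the affine hull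
  set c := (b' - a' ⬝ᵥ p) • a - (b - a ⬝ᵥ p) • a' with hc
  have hcF : ∀ r ∈ F, c ⬝ᵥ r = (b' - a' ⬝ᵥ p) * b - (b - a ⬝ᵥ p) * b' := fun r hr => by
    simp only [hc, sub_dotProduct, smul_dotProduct, smul_eq_mul, hF'2 r hr, hr.2]
  have hpq : p - q ∈ vectorSpan ℝ P := vsub_mem_vectorSpan ℝ hpP hqP
  have hspan : vectorSpan ℝ F ⊔ Submodule.span ℝ {p - q} = vectorSpan ℝ P := by
    refine Submodule.eq_of_le_of_finrank_le (sup_le (vectorSpan_mono ℝ hFP) ?_) ?_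
    · rw [Submodule.span_singleton_le_iff_mem]
      exact hpq
    · have : vectorSpan ℝ F < vectorSpan ℝ F ⊔ Submodule.span ℝ {p - q} := by
        refine lt_of_le_of_ne le_sup_left fun heq => ?_
        have h1 : p - q ∈ vectorSpan ℝ F := by
          rw [heq]
          exact Submodule.mem_sup_right (Submodule.mem_span_singleton_self _)
        have := dotProduct_eq_zero_of_mem_vectorSpan (fun p hp => (hp : p ∈ F).2) h1
        rw [dotProduct_sub] at this
        linarith
      have := Submodule.finrank_lt_finrank_of_lt this
      unfold affDim at hdim
      omega
  rw [← hspan, Submodule.mem_sup] at hxq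
  obtain ⟨y, hy, z, hz, hyz⟩ := hxq
  obtain ⟨s, rfl⟩ := Submodule.mem_span_singleton.1 hz
  have hcy := dotProduct_eq_zero_of_mem_vectorSpan hcF hy
  have hcp : c ⬝ᵥ (p - q) = 0 := by
    rw [dotProduct_sub, hcF q hqF]
    simp only [hc, sub_dotProduct, smul_dotProduct, smul_eq_mul]
    ring
  have hcx : c ⬝ᵥ (x - q) = 0 := by
    rw [← hyz, dotProduct_add, hcy, dotProduct_smul, hcp, smul_zero, add_zero]
  rw [dotProduct_sub, hcF q hqF] at hcx
  simp only [hc, sub_dotProduct, smul_dotProduct, smul_eq_mul] at hcx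
  -- `hcx` says `(b' - a' p)(a x - b) = (b - a p)(a' x - b')`, where the left side is positive and
  -- the right side is not.
  nlinarith [mul_pos (sub_pos.2 hp2) (sub_pos.2 hxb), mul_nonneg (sub_pos.2 hp1).le (sub_nonneg.2 hxb')]

end FacetDescription

/-! ### Yannakakis' theorem: from a nonnegative factorization to an extended formulation. -/

/-- `M` is a sum of `N` nonnegative matrices of rank at most one. -/
def NonnegRankLE {I J : Type*} (M : Matrix I J ℝ) (N : ℕ) : Prop :=
  ∃ (u : Fin N → I → ℝ) (w : Fin N → J → ℝ), (∀ k i, 0 ≤ u k i) ∧ (∀ k j, 0 ≤ w k j) ∧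
    ∀ i j, M i j = ∑ k, u k i * w k j

/-- The affine space carrying the extended formulation of `P` given by a factorization `u` of the
slacks `b - a x`; the variables `y k` with `u k = 0` are set to zero. -/
def extensionSpace {d N : ℕ} {I : Type*} (P : Set (Fin d → ℝ)) (a : I → Fin d → ℝ) (b : I → ℝ)
    (u : Fin N → I → ℝ) : AffineSubspace ℝ (Fin (d + N) → ℝ) where
  carrier := {z | (fun i => z (Fin.castAdd N i)) ∈ affineSpan ℝ P ∧
    (∀ f, b f - a f ⬝ᵥ (fun i => z (Fin.castAdd N i)) = ∑ k, u k f * z (Fin.natAdd d k)) ∧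
    ∀ k, u k = 0 → z (Fin.natAdd d k) = 0}
  smul_vsub_vadd_mem' c p₁ p₂ p₃ h₁ h₂ h₃ := by
    refine ⟨(affineSpan ℝ P).smul_vsub_vadd_mem c h₁.1 h₂.1 h₃.1, fun f => ?_, fun k hk => ?_⟩
    · have e : (fun i => (c • (p₁ -ᵥ p₂) +ᵥ p₃) (Fin.castAdd N i)) =
          c • ((fun i => p₁ (Fin.castAdd N i)) - fun i => p₂ (Fin.castAdd N i)) +
            fun i => p₃ (Fin.castAdd N i) := by
        ext i
        simp
      rw [e, dotProduct_add, dotProduct_smul, dotProduct_sub]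
      have e1 := h₁.2.1 f
      have e2 := h₂.2.1 f
      have e3 := h₃.2.1 f
      have e4 : ∑ k, u k f * (c • (p₁ -ᵥ p₂) +ᵥ p₃) (Fin.natAdd d k) =
          c * (∑ k, u k f * p₁ (Fin.natAdd d k) - ∑ k, u k f * p₂ (Fin.natAdd d k)) +
            ∑ k, u k f * p₃ (Fin.natAdd d k) := by
        rw [← Finset.sum_sub_distrib, Finset.mul_sum, ← Finset.sum_add_distrib]
        refine Finset.sum_congr rfl fun k _ => ?_
        simp
        ring
      rw [e4, ← e1, ← e2, ← e3]
      simp only [smul_eq_mul]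
      ring
    · simp [h₁.2.2 k hk, h₂.2.2 k hk, h₃.2.2 k hk]

/-- A nonnegative factorization of a slack matrix yields an extended formulation. -/
theorem extensionComplexity_le_of_nonnegRankLE {d N : ℕ} {P : Set (Fin d → ℝ)} (hP : IsPolytope P)
    (hPne : P.Nonempty) {S : Matrix {F : Set (Fin d → ℝ) // IsFacet P F} (P.extremePoints ℝ) ℝ}
    (hS : IsSlackMatrix P S) (hN : NonnegRankLE S N) : extensionComplexity P ≤ N := by
  obtain ⟨a, b, hface, hSab⟩ := hS
  obtain ⟨u, w, hu, hw, huw⟩ := hN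
  let y : Fin N → (Fin (d + N) → ℝ) →ₗ[ℝ] ℝ := fun k => LinearMap.proj (Fin.natAdd d k)
  let π : (Fin (d + N) → ℝ) →ₗ[ℝ] (Fin d → ℝ) := LinearMap.funLeft ℝ ℝ (Fin.castAdd N)
  set Q := polyhedron (extensionSpace P a b u) y with hQ
  have hπc : Continuous π := LinearMap.continuous_of_finiteDimensional π
  have hQP : ∀ z ∈ Q, π z ∈ P := fun z hz => by
    refine hP.mem_of_facet_inequalities hPne hz.1.1 fun F hF => ⟨_, _, hface ⟨F, hF⟩, ?_⟩
    have h1 := hz.1.2.1 ⟨F, hF⟩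
    have h2 : 0 ≤ ∑ k, u k ⟨F, hF⟩ * z (Fin.natAdd d k) :=
      Finset.sum_nonneg fun k _ => mul_nonneg (hu _ _) (hz.2 k)
    have h3 : π z = fun i => z (Fin.castAdd N i) := rfl
    rw [h3]
    linarith
  have hclosed : IsClosed Q := by
    have hc : ∀ f, Continuous fun z : Fin (d + N) → ℝ =>
        b f - a f ⬝ᵥ (fun i => z (Fin.castAdd N i)) := fun f => by
      unfold dotProduct
      fun_prop
    have : Q = π ⁻¹' (affineSpan ℝ P : Set (Fin d → ℝ)) ∩
        ((⋂ f, {z | b f - a f ⬝ᵥ (fun i => z (Fin.castAdd N i)) =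
          ∑ k, u k f * z (Fin.natAdd d k)}) ∩
        (⋂ k, ⋂ (_ : u k = 0), {z | z (Fin.natAdd d k) = 0})) ∩
        ⋂ k, {z | 0 ≤ z (Fin.natAdd d k)} := by
      ext z
      simp only [Set.mem_inter_iff, Set.mem_iInter, Set.mem_preimage]
      exact Iff.rfl
    rw [this]
    refine (((AffineSubspace.closed_of_finiteDimensional _).preimage hπc).inter
      (IsClosed.inter ?_ ?_)).inter ?_
    · exact isClosed_iInter fun f => isClosed_eq (hc f) (by fun_prop)
    · exact isClosed_iInter fun k => isClosed_iInter fun _ => isClosed_eq (by fun_prop) (by fun_prop)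
    · exact isClosed_iInter fun k => isClosed_le (by fun_prop) (by fun_prop)
  have hbdd : Bornology.IsBounded Q := by
    rw [← Bornology.forall_isBounded_image_eval_iff]
    intro j
    induction j using Fin.addCases with
    | left i =>
      refine (Bornology.forall_isBounded_image_eval_iff.2 hP.isCompact.isBounded i).subset ?_
      rintro _ ⟨z, hz, rfl⟩
      exact ⟨π z, hQP z hz, rfl⟩
    | right k =>
      by_cases hk : u k = 0
      · refine (Bornology.isBounded_singleton (x := (0 : ℝ))).subset ?_
        rintro _ ⟨z, hz, rfl⟩
        exact hz.1.2.2 k hk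
      -- A positive coefficient `u k f` bounds the variable by the slack of `f`. A variable with `u
      -- k = 0` occurs in no slack equation, hence the need to fix it at zero.
      · obtain ⟨f, hf⟩ := Function.ne_iff.1 hk
        have hfpos : 0 < u k f := lt_of_le_of_ne (hu k f) (Ne.symm hf)
        have hc : Continuous fun x : Fin d → ℝ => b f - a f ⬝ᵥ x := by
          unfold dotProduct
          fun_prop
        obtain ⟨B, hB⟩ := (hP.isCompact.image hc).bddAbove
        refine (Metric.isBounded_Icc (0 : ℝ) (B / u k f)).subset ?_
        rintro _ ⟨z, hz, rfl⟩
        refine ⟨hz.2 k, ?_⟩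
        rw [le_div_iff₀ hfpos]
        have h1 := hz.1.2.1 f
        have h2 : u k f * z (Fin.natAdd d k) ≤ ∑ k, u k f * z (Fin.natAdd d k) :=
          Finset.single_le_sum (f := fun k => u k f * z (Fin.natAdd d k))
            (fun k _ => mul_nonneg (hu _ _) (hz.2 k)) (Finset.mem_univ k)
        have h3 := hB ⟨π z, hQP z hz, rfl⟩
        have h4 : π z = fun i => z (Fin.castAdd N i) := rfl
        simp only [h4] at h3
        simp only [Function.eval]
        linarith
  have hcomp : IsCompact Q := Metric.isCompact_of_isClosed_isBounded hclosed hbdd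
  have himg : π '' Q = P := by
    refine Set.Subset.antisymm ?_ ?_
    · rintro _ ⟨z, hz, rfl⟩
      exact hQP z hz
    · conv_lhs => rw [← hP.convexHull_extremePoints]
      refine convexHull_min (fun v hv => ?_) (convex_polyhedron.linear_image π)
      classical
      have hx : (fun i => Fin.append v (fun k => if u k = 0 then 0 else w k ⟨v, hv⟩)
          (Fin.castAdd N i)) = v := by
        ext i
        simp
      -- A vertex is lifted by its own column of the factorization.
      refine ⟨Fin.append v fun k => if u k = 0 then 0 else w k ⟨v, hv⟩, ⟨⟨?_, fun f => ?_,
        fun k hk => ?_⟩, fun k => ?_⟩, hx⟩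
      · rw [hx]
        exact subset_affineSpan ℝ P hv.1
      · rw [hx, ← hSab f ⟨v, hv⟩, huw]
        refine Finset.sum_congr rfl fun k _ => ?_
        by_cases hk : u k = 0 <;> simp [hk]
      · simp [hk]
      · simp only [y, LinearMap.proj_apply, Fin.append_right]
        split_ifs
        exacts [le_rfl, hw _ _]
  have hle : extensionComplexity P ≤ {F | IsFacet Q F}.encard :=
    sInf_le ⟨d + N, Q, π, isPolytope_polyhedron hcomp, himg, rfl⟩
  refine hle.trans ?_
  simpa using encard_isFacet_polyhedron_le (L := extensionSpace P a b u) (y := y)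

/-! ### Mixtures of rectangles -/

section Mixture

open MeasureTheory ProbabilityTheory RealInnerProductSpace

variable {I J : Type*} [Fintype I] [Fintype J]

/-- `K` lies in the convex hull of the indicator matrices of rectangles, in its dual description:
no linear functional separates it from them. -/
def IsRectangleMixture (K : Matrix I J ℝ) : Prop :=
  ∀ w : Matrix I J ℝ, ∃ (A : Finset I) (B : Finset J),
    ∑ i, ∑ j, w i j * K i j ≤ ∑ i ∈ A, ∑ j ∈ B, w i j

theorem isRectangleMixture_one : IsRectangleMixture (fun (_ : I) (_ : J) => (1 : ℝ)) :=
  fun w => ⟨Finset.univ, Finset.univ, by simp⟩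

/-- Dual form of intersecting rectangles: `K'` is absorbed into the functional to find a rectangle
for `K`, then `K'` is tested on the functional restricted to that rectangle. -/
theorem IsRectangleMixture.mul {K K' : Matrix I J ℝ} (hK : IsRectangleMixture K)
    (hK' : IsRectangleMixture K') : IsRectangleMixture (fun i j => K i j * K' i j) := by
  classical
  intro w
  obtain ⟨A, B, h⟩ := hK fun i j => w i j * K' i j
  obtain ⟨A', B', h'⟩ := hK' fun i j => if i ∈ A ∧ j ∈ B then w i j else 0
  refine ⟨A' ∩ A, B' ∩ B, ?_⟩
  calc ∑ i, ∑ j, w i j * (K i j * K' i j) = ∑ i, ∑ j, w i j * K' i j * K i j :=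
        Finset.sum_congr rfl fun i _ => Finset.sum_congr rfl fun j _ => by ring
    _ ≤ ∑ i ∈ A, ∑ j ∈ B, w i j * K' i j := h
    _ = ∑ i, ∑ j, (if i ∈ A ∧ j ∈ B then w i j else 0) * K' i j := by
        simp [ite_and, ite_mul, Finset.sum_ite_mem]
    _ ≤ _ := h'
    _ = _ := by
        rw [← Finset.sum_ite_mem]
        refine Finset.sum_congr rfl fun i _ => ?_
        by_cases hi : i ∈ A <;> simp [hi, Finset.sum_ite_mem]

theorem IsRectangleMixture.pow {K : Matrix I J ℝ} (hK : IsRectangleMixture K) (T : ℕ) :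
    IsRectangleMixture (fun i j => K i j ^ T) := by
  induction T with
  | zero => simpa using isRectangleMixture_one (I := I) (J := J)
  | succ T ih => simpa only [pow_succ] using ih.mul hK

theorem exists_finset_sum_mul_le {ι : Type*} [Fintype ι] (c a : ι → ℝ) (h0 : ∀ i, 0 ≤ a i)
    (h1 : ∀ i, a i ≤ 1) : ∃ A : Finset ι, ∑ i, c i * a i ≤ ∑ i ∈ A, c i := by
  classical
  refine ⟨Finset.univ.filter fun i => 0 ≤ c i, ?_⟩
  rw [Finset.sum_filter]
  refine Finset.sum_le_sum fun i _ => ?_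
  split_ifs with h
  · exact mul_le_of_le_one_right h (h1 i)
  · exact mul_nonpos_of_nonpos_of_nonneg (not_le.1 h).le (h0 i)

theorem exists_rectangle_of_fractional (w : Matrix I J ℝ) (a : I → ℝ) (b : J → ℝ)
    (ha0 : ∀ i, 0 ≤ a i) (ha1 : ∀ i, a i ≤ 1) (hb0 : ∀ j, 0 ≤ b j) (hb1 : ∀ j, b j ≤ 1) :
    ∃ (A : Finset I) (B : Finset J), ∑ i, ∑ j, w i j * (a i * b j) ≤ ∑ i ∈ A, ∑ j ∈ B, w i j := by
  obtain ⟨A, hA⟩ := exists_finset_sum_mul_le (fun i => ∑ j, w i j * b j) a ha0 ha1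
  obtain ⟨B, hB⟩ := exists_finset_sum_mul_le (fun j => ∑ i ∈ A, w i j) b hb0 hb1
  refine ⟨A, B, ?_⟩
  calc ∑ i, ∑ j, w i j * (a i * b j) = ∑ i, (∑ j, w i j * b j) * a i := by
        refine Finset.sum_congr rfl fun i _ => ?_
        rw [Finset.sum_mul]
        exact Finset.sum_congr rfl fun j _ => by ring
    _ ≤ ∑ i ∈ A, ∑ j, w i j * b j := hA
    _ = ∑ j, (∑ i ∈ A, w i j) * b j := by
        rw [Finset.sum_comm]
        exact Finset.sum_congr rfl fun j _ => by rw [Finset.sum_mul]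
    _ ≤ ∑ j ∈ B, ∑ i ∈ A, w i j := hB
    _ = _ := Finset.sum_comm

variable {E : Type*} [NormedAddCommGroup E] [InnerProductSpace ℝ E] [FiniteDimensional ℝ E]
  [MeasurableSpace E] [BorelSpace E]

theorem integrable_cos_inner (t : E) :
    Integrable (fun g : E => Real.cos ⟪g, t⟫) (stdGaussian E) := by
  refine Integrable.of_bound (by fun_prop) 1 (Filter.Eventually.of_forall fun g => ?_)
  rw [Real.norm_eq_abs]
  exact Real.abs_cos_le_one _

theorem integral_cos_inner_stdGaussian (t : E) :
    ∫ g, Real.cos ⟪g, t⟫ ∂(stdGaussian E) = Real.exp (-‖t‖ ^ 2 / 2) := by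
  have h := charFun_stdGaussian t
  rw [charFun_apply] at h
  have hexpI : Integrable (fun g : E => Complex.exp (⟪g, t⟫ * Complex.I)) (stdGaussian E) := by
    refine Integrable.of_bound (by fun_prop) 1 (Filter.Eventually.of_forall fun g => ?_)
    rw [Complex.norm_exp_ofReal_mul_I]
  have h2 := Complex.reCLM.integral_comp_comm hexpI
  rw [h] at h2
  simp only [Complex.reCLM_apply, Complex.exp_ofReal_mul_I_re] at h2
  rw [h2]
  norm_cast

/-- Random Fourier features: a Gaussian kernel is, up to scaling and shift, a mixture of
rectangles. -/
theorem isRectangleMixture_exp_inner (U : I → E) (V : J → E) (hU : ∀ i, ‖U i‖ ≤ 1)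
    (hV : ∀ j, ‖V j‖ ≤ 1) :
    IsRectangleMixture
      (fun i j => (1 / 4 : ℝ) * (1 + 1 / 2 * Real.exp (-1) * Real.exp ⟪U i, V j⟫)) := by
  intro w
  -- These factors complete the square: `α i * β j * exp (-‖U i - V j‖ ^ 2 / 2) = exp (-1 + ⟪U i, V
  -- j⟫)`. The norm bounds keep them in `[0, 1]`.
  set α : I → ℝ := fun i => Real.exp (-(1 - ‖U i‖ ^ 2) / 2) with hα
  set β : J → ℝ := fun j => Real.exp (-(1 - ‖V j‖ ^ 2) / 2) with hβ
  have hα0 : ∀ i, 0 ≤ α i := fun i => (Real.exp_pos _).le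
  have hβ0 : ∀ j, 0 ≤ β j := fun j => (Real.exp_pos _).le
  have hα1 : ∀ i, α i ≤ 1 := fun i => by
    refine Real.exp_le_one_iff.2 ?_
    have := pow_le_one₀ (n := 2) (norm_nonneg _) (hU i)
    linarith
  have hβ1 : ∀ j, β j ≤ 1 := fun j => by
    refine Real.exp_le_one_iff.2 ?_
    have := pow_le_one₀ (n := 2) (norm_nonneg _) (hV j)
    linarith
  have hbd : ∀ {s x : ℝ}, 0 ≤ s → s ≤ 1 → |x| ≤ 1 → 0 ≤ (1 + s * x) / 2 ∧ (1 + s * x) / 2 ≤ 1 := by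
    intro s x h0 h1 hx
    have : |s * x| ≤ 1 := by
      rw [abs_mul, abs_of_nonneg h0]
      exact mul_le_one₀ h1 (abs_nonneg _) hx
    rw [abs_le] at this
    constructor <;> linarith
  set F : E → ℝ := fun g => ∑ i, ∑ j, w i j *
    (1 / 4 * (1 + 1 / 2 * (α i * β j * Real.cos ⟪g, U i - V j⟫))) with hF
  have hterm : ∀ i j, Integrable (fun g => w i j *
      (1 / 4 * (1 + 1 / 2 * (α i * β j * Real.cos ⟪g, U i - V j⟫)))) (stdGaussian E) :=
    fun i j => (((integrable_const _).add
      (((integrable_cos_inner _).const_mul _).const_mul _)).const_mul _).const_mul _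
  have hFint : Integrable F (stdGaussian E) :=
    integrable_finsetSum _ fun i _ => integrable_finsetSum _ fun j _ => hterm i j
  have hFval : ∫ g, F g ∂(stdGaussian E) = ∑ i, ∑ j, w i j *
      ((1 / 4 : ℝ) * (1 + 1 / 2 * Real.exp (-1) * Real.exp ⟪U i, V j⟫)) := by
    rw [hF, integral_finsetSum _ fun i _ => integrable_finsetSum _ fun j _ => hterm i j]
    refine Finset.sum_congr rfl fun i _ => ?_
    rw [integral_finsetSum _ fun j _ => hterm i j]
    refine Finset.sum_congr rfl fun j _ => ?_
    rw [integral_const_mul, integral_const_mul, integral_add (integrable_const _)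
      (((integrable_cos_inner _).const_mul _).const_mul _), integral_const_mul, integral_const_mul,
      integral_cos_inner_stdGaussian]
    have : α i * β j * Real.exp (-‖U i - V j‖ ^ 2 / 2) =
        Real.exp (-1) * Real.exp ⟪U i, V j⟫ := by
      rw [hα, hβ, ← Real.exp_add, ← Real.exp_add, ← Real.exp_add, norm_sub_sq_real]
      ring_nf
    rw [this, integral_const, probReal_univ, one_smul]
    ring
  obtain ⟨g, hg⟩ := exists_integral_le hFint
  rw [hFval] at hg
  -- one of four fractional rectangles attains the average
  let c : I → ℝ := fun i => Real.cos ⟪g, U i⟫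
  let s : I → ℝ := fun i => Real.sin ⟪g, U i⟫
  let c' : J → ℝ := fun j => Real.cos ⟪g, V j⟫
  let s' : J → ℝ := fun j => Real.sin ⟪g, V j⟫
  let G : (I → ℝ) → (J → ℝ) → ℝ := fun x y =>
    ∑ i, ∑ j, w i j * ((1 + α i * x i) / 2 * ((1 + β j * y j) / 2))
  have hround : ∀ (x : I → ℝ) (y : J → ℝ), (∀ i, |x i| ≤ 1) → (∀ j, |y j| ≤ 1) →
      ∃ (A : Finset I) (B : Finset J), G x y ≤ ∑ i ∈ A, ∑ j ∈ B, w i j := fun x y hx hy =>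
    exists_rectangle_of_fractional w _ _ (fun i => (hbd (hα0 i) (hα1 i) (hx i)).1)
      (fun i => (hbd (hα0 i) (hα1 i) (hx i)).2) (fun j => (hbd (hβ0 j) (hβ1 j) (hy j)).1)
      (fun j => (hbd (hβ0 j) (hβ1 j) (hy j)).2)
  -- `cos (a - b)` splits into two products, and for each of them adding the pair with both signs
  -- flipped cancels the linear terms: `(1 + x)(1 + y) + (1 - x)(1 - y) = 2(1 + xy)`.
  have hsum : F g = (1 / 4 : ℝ) * (G c c' + G (-c) (-c') + G s s' + G (-s) (-s')) := by
    simp only [G, hF, ← Finset.sum_add_distrib, Finset.mul_sum]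
    refine Finset.sum_congr rfl fun i _ => Finset.sum_congr rfl fun j _ => ?_
    rw [inner_sub_right, Real.cos_sub]
    simp only [Pi.neg_apply, c, c', s, s']
    ring
  obtain ⟨A₁, B₁, h₁⟩ := hround c c' (fun _ => Real.abs_cos_le_one _) fun _ => Real.abs_cos_le_one _
  obtain ⟨A₂, B₂, h₂⟩ := hround (-c) (-c') (fun _ => by simp [c, Real.abs_cos_le_one])
    fun _ => by simp [c', Real.abs_cos_le_one]
  obtain ⟨A₃, B₃, h₃⟩ := hround s s' (fun _ => Real.abs_sin_le_one _) fun _ => Real.abs_sin_le_one _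
  obtain ⟨A₄, B₄, h₄⟩ := hround (-s) (-s') (fun _ => by simp [s, Real.abs_sin_le_one])
    fun _ => by simp [s', Real.abs_sin_le_one]
  by_contra! hcon
  linarith [hcon A₁ B₁, hcon A₂ B₂, hcon A₃ B₃, hcon A₄ B₄]

end Mixture

/-! ### Factorization of bounded matrices through an optimal design -/

/-- Both sides equal `1` at `s = 0`, so their right derivatives there compare. -/
theorem le_of_forall_one_add_mul_le_pow {q : ℝ} {r : ℕ}
    (h : ∀ s : ℝ, 0 ≤ s → 1 + s * q ≤ (1 + s) ^ r) : q ≤ r := by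
  have hd : HasDerivAt (fun s : ℝ => (1 + s) ^ r - (1 + s * q)) (r - q) 0 := by
    have h1 : HasDerivAt (fun s : ℝ => (1 + s) ^ r) (r * (1 + 0) ^ (r - 1) * 1) (0 : ℝ) :=
      ((hasDerivAt_id (0 : ℝ)).const_add 1).pow r
    have h2 : HasDerivAt (fun s : ℝ => 1 + s * q) (1 * q) (0 : ℝ) :=
      ((hasDerivAt_id (0 : ℝ)).mul_const q).const_add 1
    exact (h1.sub h2).congr_deriv (by simp)
  have hlim := hd.tendsto_slope_zero_right
  have : (0 : ℝ) ≤ r - q := by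
    refine ge_of_tendsto hlim ?_
    filter_upwards [self_mem_nhdsWithin] with t ht
    have ht : 0 < t := ht
    have := h t ht.le
    simp only [zero_add, add_zero, one_pow, zero_mul, sub_self, sub_zero, smul_eq_mul]
    exact mul_nonneg (inv_nonneg.2 ht.le) (by linarith)
  linarith

section Design

open Matrix

variable {I J : Type*} [Fintype I] [Fintype J]

theorem exists_rank_factorization (M : Matrix I J ℝ) :
    ∃ (u : Matrix I (Fin M.rank) ℝ) (v : Matrix (Fin M.rank) J ℝ), M = u * v := by
  have hr : Module.finrank ℝ (Submodule.span ℝ (Set.range M.row)) = M.rank :=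
    M.rank_eq_finrank_span_row.symm
  let b := Module.finBasisOfFinrankEq ℝ _ hr
  refine ⟨Matrix.of fun i => b.repr ⟨M i, Submodule.subset_span ⟨i, rfl⟩⟩,
    Matrix.of fun k => (b k).1, ?_⟩
  ext i j
  have := congrArg Subtype.val (b.sum_repr ⟨M i, Submodule.subset_span ⟨i, rfl⟩⟩)
  have := congrFun this j
  simp only [Submodule.coe_sum, Submodule.coe_smul, Finset.sum_apply, Pi.smul_apply,
    smul_eq_mul] at this
  rw [Matrix.mul_apply]
  exact this.symm

/-- The moment matrix of a weighting of the rows of `u`. -/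
def momentMatrix {r : ℕ} (u : Matrix I (Fin r) ℝ) (p : I → ℝ) : Matrix (Fin r) (Fin r) ℝ :=
  ∑ k, p k • vecMulVec (u k) (u k)

theorem isSymm_momentMatrix {r : ℕ} (u : Matrix I (Fin r) ℝ) (p : I → ℝ) :
    (momentMatrix u p).IsSymm := by
  ext a b
  simp [momentMatrix, Matrix.sum_apply, vecMulVec_apply, mul_comm]

theorem momentMatrix_mulVec {r : ℕ} (u : Matrix I (Fin r) ℝ) (p : I → ℝ) (z : Fin r → ℝ) :
    momentMatrix u p *ᵥ z = ∑ k, (p k * (u k ⬝ᵥ z)) • u k := by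
  ext a
  simp only [momentMatrix, mulVec, dotProduct, Matrix.sum_apply, Matrix.smul_apply,
    vecMulVec_apply, Finset.sum_apply, Pi.smul_apply, smul_eq_mul, Finset.mul_sum, Finset.sum_mul]
  rw [Finset.sum_comm]
  exact Finset.sum_congr rfl fun k _ => Finset.sum_congr rfl fun b _ => by ring

theorem momentMatrix_const {r : ℕ} (u : Matrix I (Fin r) ℝ) (c : ℝ) :
    momentMatrix u (fun _ => c) = c • (uᵀ * u) := by
  ext a b
  simp [momentMatrix, Matrix.sum_apply, vecMulVec_apply, Matrix.mul_apply, Finset.mul_sum]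

/-- Optimal design: the weighting of the rows of a matrix of full column rank that
maximizes the determinant of the moment matrix. -/
theorem exists_optimal_design [Nonempty I] {r : ℕ} (u : Matrix I (Fin r) ℝ) (hu : u.rank = r) :
    ∃ p : I → ℝ, (∀ k, 0 ≤ p k) ∧ ∑ k, p k = 1 ∧ IsUnit (momentMatrix u p).det ∧
      ∀ i, 0 ≤ u i ⬝ᵥ (momentMatrix u p)⁻¹ *ᵥ u i →
        u i ⬝ᵥ (momentMatrix u p)⁻¹ *ᵥ u i ≤ r := by
  classical
  -- Squaring the determinant avoids a proof that it is nonnegative.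
  have hcont : Continuous fun p : I → ℝ => (momentMatrix u p).det ^ 2 := by
    unfold momentMatrix
    fun_prop
  have hunif : (fun _ => (Fintype.card I : ℝ)⁻¹) ∈ stdSimplex ℝ I :=
    ⟨fun _ => by positivity, by simp⟩
  obtain ⟨p, hp, hmax⟩ := (isCompact_stdSimplex ℝ I).exists_isMaxOn ⟨_, hunif⟩ hcont.continuousOn
  have hdet : (momentMatrix u p).det ≠ 0 := by
    intro h0
    have h1 : (momentMatrix u fun _ => (Fintype.card I : ℝ)⁻¹).det ^ 2 ≤
      (momentMatrix u p).det ^ 2 := hmax hunif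
    rw [h0, momentMatrix_const, det_smul] at h1
    have h3 : (uᵀ * u).det = 0 := by simpa using h1
    have h4 := rank_transpose_mul_self u
    rw [hu] at h4
    obtain ⟨x, hx0, hx⟩ := exists_mulVec_eq_zero_iff.2 h3
    have h5 := (uᵀ * u).mulVecLin.finrank_range_add_finrank_ker
    have h6 : Module.finrank ℝ (LinearMap.range (uᵀ * u).mulVecLin) = r := h4
    rw [h6, Module.finrank_fin_fun] at h5
    have h7 : LinearMap.ker (uᵀ * u).mulVecLin = ⊥ := Submodule.finrank_eq_zero.1 (by omega)
    have h8 : x ∈ LinearMap.ker (uᵀ * u).mulVecLin := hx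
    rw [h7] at h8
    exact hx0 h8
  refine ⟨p, hp.1, hp.2, hdet.isUnit, fun i hq => le_of_forall_one_add_mul_le_pow fun s hs => ?_⟩
  set S := momentMatrix u p with hS
  set q := u i ⬝ᵥ S⁻¹ *ᵥ u i with hqdef
  have hs1 : 0 < 1 + s := by linarith
  -- Weight `s` is moved to row `i`. The matrix determinant lemma gives the determinant ratio `(1 +
  -- s) ^ (-r) * (1 + s * q)`, which maximality bounds by `1`.
  let p' : I → ℝ := fun k => (1 + s)⁻¹ * (p k + if k = i then s else 0)
  have hp' : p' ∈ stdSimplex ℝ I := by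
    refine ⟨fun k => ?_, ?_⟩
    · have := hp.1 k
      simp only [p']
      split_ifs <;> positivity
    · simp only [p', ← Finset.mul_sum, Finset.sum_add_distrib, hp.2, Finset.sum_ite_eq',
        Finset.mem_univ, if_true]
      exact inv_mul_cancel₀ hs1.ne'
  have hS' : momentMatrix u p' = (1 + s)⁻¹ • (S * (1 + replicateCol Unit (s • S⁻¹ *ᵥ u i) *
      replicateRow Unit (u i))) := by
    have h1 : S * (replicateCol Unit (s • S⁻¹ *ᵥ u i) * replicateRow Unit (u i)) =
        s • vecMulVec (u i) (u i) := by
      rw [← Matrix.mul_assoc, ← replicateCol_mulVec, mulVec_smul, mulVec_mulVec,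
        mul_nonsing_inv _ hdet.isUnit, one_mulVec, ← vecMulVec_eq, smul_vecMulVec]
    rw [Matrix.mul_add, Matrix.mul_one, h1, hS]
    simp only [momentMatrix, p', mul_smul, add_smul, ← Finset.smul_sum, Finset.sum_add_distrib]
    congr 2
    simp [ite_smul]
  have h1 : (momentMatrix u p').det ^ 2 ≤ S.det ^ 2 := hmax hp'
  have h2 : (momentMatrix u p').det = ((1 + s)⁻¹ ^ r * (1 + s * q)) * S.det := by
    rw [hS', det_smul, det_mul, det_one_add_replicateCol_mul_replicateRow, dotProduct_smul,
      Fintype.card_fin, smul_eq_mul]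
    ring
  rw [h2, mul_pow] at h1
  have h3 : ((1 + s)⁻¹ ^ r * (1 + s * q)) ^ 2 ≤ 1 := by
    have : 0 < S.det ^ 2 := by positivity
    by_contra! hcon
    nlinarith
  have h4 : (1 + s)⁻¹ ^ r * (1 + s * q) ≤ 1 := by
    rw [sq_le_one_iff_abs_le_one] at h3
    exact (le_abs_self _).trans h3
  rwa [inv_pow, inv_mul_le_iff₀ (by positivity), mul_one] at h4

/-- A matrix of rank `r` with entries bounded by `D` factors through vectors of norms at most
`√r` and `D`. -/
theorem exists_bounded_factorization [Nonempty I] (M : Matrix I J ℝ) {D : ℝ} (hD : 0 ≤ D)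
    (hM : ∀ i j, |M i j| ≤ D) :
    ∃ (x : I → EuclideanSpace ℝ I) (y : J → EuclideanSpace ℝ I), (∀ i j, inner ℝ (x i) (y j) = M i j) ∧
      (∀ i, ‖x i‖ ≤ √M.rank) ∧ ∀ j, ‖y j‖ ≤ D := by
  obtain ⟨u, v, huv⟩ := exists_rank_factorization M
  have hur : u.rank = M.rank := by
    refine le_antisymm (by simpa using u.rank_le_card_width) ?_
    conv_lhs => rw [huv]
    exact rank_mul_le_left u v
  obtain ⟨p, hp0, hp1, hdet, hq⟩ := exists_optimal_design u hur
  set S := momentMatrix u p with hS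
  have hsymm : (S⁻¹)ᵀ = S⁻¹ := by
    rw [transpose_nonsing_inv, (isSymm_momentMatrix u p).eq]
  have hcomm : ∀ a b : Fin M.rank → ℝ, a ⬝ᵥ S⁻¹ *ᵥ b = b ⬝ᵥ S⁻¹ *ᵥ a := fun a b => by
    rw [dotProduct_mulVec, ← mulVec_transpose, hsymm, dotProduct_comm]
  -- Inserting `S⁻¹ * S` gives a reproducing formula that factors `M` through its own rows. The
  -- squared norm of `x i` is then the quantity bounded by the design, and that of `y j` is a
  -- `p`-average of squared entries.
  have hrep : ∀ i z, ∑ k, p k * (u i ⬝ᵥ S⁻¹ *ᵥ u k) * (u k ⬝ᵥ z) = u i ⬝ᵥ z := fun i z => by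
    have h1 : S⁻¹ *ᵥ (S *ᵥ z) = z := by
      rw [mulVec_mulVec, nonsing_inv_mul _ hdet, one_mulVec]
    conv_rhs => rw [← h1, hS, momentMatrix_mulVec, mulVec_sum, dotProduct_sum]
    refine Finset.sum_congr rfl fun k _ => ?_
    rw [mulVec_smul, dotProduct_smul, smul_eq_mul]
    ring
  have hMuv : ∀ i j, M i j = u i ⬝ᵥ fun k => v k j := fun i j => by
    conv_lhs => rw [huv]
    rfl
  have hnorm : ∀ i, ∑ k, p k * (u i ⬝ᵥ S⁻¹ *ᵥ u k) ^ 2 = u i ⬝ᵥ S⁻¹ *ᵥ u i := fun i => by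
    rw [← hrep i (S⁻¹ *ᵥ u i)]
    refine Finset.sum_congr rfl fun k _ => ?_
    rw [hcomm (u k) (u i)]
    ring
  refine ⟨fun i => WithLp.toLp 2 fun k => √(p k) * (u i ⬝ᵥ S⁻¹ *ᵥ u k),
    fun j => WithLp.toLp 2 fun k => √(p k) * M k j, fun i j => ?_, fun i => ?_, fun j => ?_⟩
  · simp only [PiLp.inner_apply, RCLike.inner_apply, conj_trivial]
    rw [hMuv i j, ← hrep]
    refine Finset.sum_congr rfl fun k _ => ?_
    rw [← hMuv k j]
    conv_rhs => rw [← Real.mul_self_sqrt (hp0 k)]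
    ring
  · rw [EuclideanSpace.norm_eq]
    refine Real.sqrt_le_sqrt ?_
    have : ∑ k, ‖√(p k) * (u i ⬝ᵥ S⁻¹ *ᵥ u k)‖ ^ 2 = u i ⬝ᵥ S⁻¹ *ᵥ u i := by
      rw [← hnorm i]
      refine Finset.sum_congr rfl fun k _ => ?_
      rw [Real.norm_eq_abs, sq_abs, mul_pow, Real.sq_sqrt (hp0 k)]
    simp only [this]
    refine hq i ?_
    rw [← hnorm i]
    exact Finset.sum_nonneg fun k _ => mul_nonneg (hp0 k) (sq_nonneg _)
  · rw [EuclideanSpace.norm_eq]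
    refine Real.sqrt_le_iff.2 ⟨hD, ?_⟩
    calc ∑ k, ‖√(p k) * M k j‖ ^ 2 = ∑ k, p k * M k j ^ 2 := by
          refine Finset.sum_congr rfl fun k _ => ?_
          rw [Real.norm_eq_abs, sq_abs, mul_pow, Real.sq_sqrt (hp0 k)]
      _ ≤ ∑ k, p k * D ^ 2 := by
          refine Finset.sum_le_sum fun k _ => mul_le_mul_of_nonneg_left ?_ (hp0 k)
          exact sq_le_sq' (neg_le_of_abs_le (hM k j)) (le_of_abs_le (hM k j))
      _ = D ^ 2 := by rw [← Finset.sum_mul, hp1, one_mul]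

end Design

/-! ### Large monochromatic rectangles -/

/-- Among the exponents `T ≤ (2Δ + 1) T₀` there is one for which a single term of
`∑ μ w * κ w ^ T` dominates all the others. -/
theorem exists_dominant_value {Δ T₀ : ℕ} (hT₀ : 0 < T₀) {μ κ : ℕ → ℝ} {η : ℝ} (hη : 1 < η)
    (hμ : ∀ w, 0 ≤ μ w) (hpos : ∃ w ≤ Δ, 0 < μ w) (hκ : ∀ w, 0 < κ w)
    (hκη : ∀ u w, u < w → η * κ u ≤ κ w) :
    ∃ T ≤ (2 * Δ + 1) * T₀, ∃ v ≤ Δ,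
      ∀ w ≤ Δ, w ≠ v → η ^ T₀ * (μ w * κ w ^ T) ≤ μ v * κ v ^ T := by
  -- The maximizer `v k` at exponent `2 * k * T₀` is nondecreasing in `k`, because a larger exponent
  -- favours larger `κ`. Being at most `Δ`, it must repeat at two consecutive steps.
  have hmax : ∀ k : ℕ, ∃ v ≤ Δ, ∀ w ≤ Δ,
      μ w * κ w ^ (2 * k * T₀) ≤ μ v * κ v ^ (2 * k * T₀) := fun k => by
    obtain ⟨v, hv, h⟩ := Finset.exists_max_image (Finset.range (Δ + 1))
      (fun w => μ w * κ w ^ (2 * k * T₀)) ⟨0, by simp⟩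
    exact ⟨v, by simpa [Nat.lt_succ_iff] using hv, fun w hw => h w (by simpa [Nat.lt_succ_iff])⟩
  choose v hvΔ hv using hmax
  have hμv : ∀ k, 0 < μ (v k) := fun k => by
    obtain ⟨w, hw, hw0⟩ := hpos
    have h1 := hv k w hw
    have h2 : 0 < μ w * κ w ^ (2 * k * T₀) := mul_pos hw0 (pow_pos (hκ w) _)
    exact pos_of_mul_pos_left (h2.trans_le h1) (pow_pos (hκ _) _).le
  have hκlt : ∀ u w, u < w → κ u < κ w := fun u w h => by
    nlinarith [hκη u w h, hκ u]
  have hmono : ∀ k, v k ≤ v (k + 1) := fun k => by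
    by_contra! hlt
    have h1 := hv k (v (k + 1)) (hvΔ _)
    have h2 := hv (k + 1) (v k) (hvΔ _)
    have e : 2 * (k + 1) * T₀ = 2 * k * T₀ + 2 * T₀ := by ring
    rw [e, pow_add, pow_add, ← mul_assoc, ← mul_assoc] at h2
    have h3 : κ (v (k + 1)) ^ (2 * T₀) < κ (v k) ^ (2 * T₀) :=
      pow_lt_pow_left₀ (hκlt _ _ hlt) (hκ _).le (by omega)
    have h4 : 0 < μ (v k) * κ (v k) ^ (2 * k * T₀) := mul_pos (hμv k) (pow_pos (hκ _) _)
    have h5 := mul_le_mul_of_nonneg_right h1 (pow_pos (hκ (v (k + 1))) (2 * T₀)).le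
    have h6 := mul_lt_mul_of_pos_left h3 h4
    linarith
  obtain ⟨k, hkΔ, hk⟩ : ∃ k ≤ Δ, v (k + 1) = v k := by
    by_contra! hcon
    have : ∀ k ≤ Δ + 1, k ≤ v k := fun k => by
      induction k with
      | zero => simp
      | succ k ih =>
        intro h
        have h1 := ih (by omega)
        have h2 := hmono k
        have h3 := hcon k (by omega)
        omega
    have := this (Δ + 1) le_rfl
    have := hvΔ (Δ + 1)
    omega
  -- Halfway between two exponents with the same maximizer, the gain `η ^ T₀` over smaller values
  -- comes from the left exponent and over larger values from the right one.
  refine ⟨(2 * k + 1) * T₀, Nat.mul_le_mul_right _ (by omega), v k, hvΔ k, fun w hw hne => ?_⟩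
  have e1 : (2 * k + 1) * T₀ = 2 * k * T₀ + T₀ := by ring
  have e2 : 2 * (k + 1) * T₀ = (2 * k + 1) * T₀ + T₀ := by ring
  have hη0 : 0 < η := by linarith
  rcases hne.lt_or_gt with h | h
  · have h1 := hv k w hw
    have h2 : (η * κ w) ^ T₀ ≤ κ (v k) ^ T₀ :=
      pow_le_pow_left₀ (mul_pos hη0 (hκ w)).le (hκη w (v k) h) _
    rw [e1, pow_add, pow_add]
    calc η ^ T₀ * (μ w * (κ w ^ (2 * k * T₀) * κ w ^ T₀))
        = μ w * κ w ^ (2 * k * T₀) * (η * κ w) ^ T₀ := by rw [mul_pow]; ring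
      _ ≤ μ (v k) * κ (v k) ^ (2 * k * T₀) * κ (v k) ^ T₀ :=
          mul_le_mul h1 h2 (pow_pos (mul_pos hη0 (hκ w)) _).le
            (mul_pos (hμv k) (pow_pos (hκ _) _)).le
      _ = _ := by ring
  · have h1 := hv (k + 1) w hw
    have h2 : (η * κ (v k)) ^ T₀ ≤ κ w ^ T₀ :=
      pow_le_pow_left₀ (mul_pos hη0 (hκ _)).le (hκη (v k) w h) _
    rw [hk, e2, pow_add, pow_add, ← mul_assoc, ← mul_assoc] at h1
    refine le_of_mul_le_mul_right ?_ (pow_pos (hκ (v k)) T₀)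
    calc η ^ T₀ * (μ w * κ w ^ ((2 * k + 1) * T₀)) * κ (v k) ^ T₀
        = μ w * κ w ^ ((2 * k + 1) * T₀) * (η * κ (v k)) ^ T₀ := by rw [mul_pow]; ring
      _ ≤ μ w * κ w ^ ((2 * k + 1) * T₀) * κ w ^ T₀ :=
          mul_le_mul_of_nonneg_left h2 (mul_nonneg (hμ w) (pow_pos (hκ _) _).le)
      _ ≤ _ := h1

theorem eq_of_mem_span_rows {I J : Type*} {M : Matrix I J ℝ} {t : Set I} {j j' : J}
    (h : ∀ i ∈ t, M i j = M i j') {f : J → ℝ} (hf : f ∈ Submodule.span ℝ (M.row '' t)) :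
    f j = f j' := by
  induction hf using Submodule.span_induction with
  | mem x hx =>
    obtain ⟨i, hi, rfl⟩ := hx
    exact h i hi
  | zero => rfl
  | add x y _ _ hx hy => simp [hx, hy]
  | smul c x _ hx => simp [hx]

section Rectangles

open RealInnerProductSpace

variable {I J : Type*} [Fintype I] [Fintype J]

theorem sum_comp_eq_sum_card {Δ : ℕ} {A : Matrix I J ℕ} (hA : ∀ i j, A i j ≤ Δ) (φ : ℕ → ℝ) :
    ∑ i, ∑ j, φ (A i j) = ∑ w ∈ Finset.range (Δ + 1),
      ((Finset.univ.filter fun p : I × J => A p.1 p.2 = w).card : ℝ) * φ w := by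
  rw [← Fintype.sum_prod_type' fun i j => φ (A i j),
    ← Finset.sum_fiberwise_of_maps_to (t := Finset.range (Δ + 1)) (g := fun p : I × J => A p.1 p.2)
      (fun p _ => by simpa [Nat.lt_succ_iff] using hA p.1 p.2)]
  refine Finset.sum_congr rfl fun w _ => ?_
  rw [Finset.sum_congr rfl (g := fun _ => φ w) fun p hp => by rw [(Finset.mem_filter.1 hp).2]]
  simp

theorem isRectangleMixture_of_rank_le [Nonempty I] {Δ r : ℕ} (hΔ : 0 < Δ) (hr : 0 < r)
    {A : Matrix I J ℕ} (hA : ∀ i j, A i j ≤ Δ) (hrank : (A.map (Nat.cast : ℕ → ℝ)).rank ≤ r) :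
    IsRectangleMixture fun i j =>
      (1 / 4 : ℝ) * (1 + 1 / 2 * Real.exp (-1) * Real.exp (1 / (Δ * √r) * A i j)) := by
  have hΔ' : (0 : ℝ) < Δ := by exact_mod_cast hΔ
  have hr' : (0 : ℝ) < √r := Real.sqrt_pos.2 (by exact_mod_cast hr)
  obtain ⟨x, y, hxy, hx, hy⟩ := exists_bounded_factorization (A.map (Nat.cast : ℕ → ℝ))
    (D := Δ) hΔ'.le (fun i j => by simpa using hA i j)
  have := isRectangleMixture_exp_inner (fun i => (√r)⁻¹ • x i) (fun j => (Δ : ℝ)⁻¹ • y j)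
    (fun i => by
      rw [norm_smul, norm_inv, Real.norm_of_nonneg hr'.le, inv_mul_le_iff₀ hr', mul_one]
      exact (hx i).trans (Real.sqrt_le_sqrt (by exact_mod_cast hrank)))
    (fun j => by
      rw [norm_smul, norm_inv, Real.norm_of_nonneg hΔ'.le, inv_mul_le_iff₀ hΔ', mul_one]
      exact hy j)
  have e : ∀ i j, ⟪(√r)⁻¹ • x i, (Δ : ℝ)⁻¹ • y j⟫ = 1 / (Δ * √r) * A i j := fun i j => by
    rw [real_inner_smul_left, real_inner_smul_right, hxy, Matrix.map_apply]
    field_simp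
  simpa only [e] using this

/-- The test functional rewards the dominant value `v` and charges `K` for any other. Each of the
`Δ` other values costs at most `1 / (2 * Δ)` of the dominant term, so half of it survives. That term
is large because the kernel is at least `1 / 4` everywhere. -/
theorem exists_almost_monochromatic [Nonempty I] [Nonempty J] {Δ r T₀ : ℕ} (hΔ : 0 < Δ)
    (hr : 0 < r) (hT₀ : 0 < T₀) {A : Matrix I J ℕ} (hA : ∀ i j, A i j ≤ Δ)
    (hrank : (A.map (Nat.cast : ℕ → ℝ)).rank ≤ r) {K : ℝ}
    (hKT : 2 * K * Δ ≤ (1 + 1 / (Δ * √r) / 7) ^ T₀) :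
    ∃ (R : Finset I) (C : Finset J) (v : ℕ), (Fintype.card I * Fintype.card J : ℝ) ≤
      2 * (Δ + 1) * 4 ^ ((2 * Δ + 1) * T₀) *
        ∑ i ∈ R, ∑ j ∈ C, if A i j = v then (1 : ℝ) else -K := by
  have hΔ' : (0 : ℝ) < Δ := by exact_mod_cast hΔ
  have hr' : (0 : ℝ) < √r := Real.sqrt_pos.2 (by exact_mod_cast hr)
  set ε : ℝ := 1 / (Δ * √r) with hε
  have hε0 : 0 < ε := by positivity
  let κ : ℕ → ℝ := fun w => 1 / 4 * (1 + 1 / 2 * Real.exp (-1) * Real.exp (ε * w))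
  let μ : ℕ → ℝ := fun w => ((Finset.univ.filter fun p : I × J => A p.1 p.2 = w).card : ℝ)
  have hκ4 : ∀ w, 1 / 4 ≤ κ w := fun w => by
    have : 0 < 1 / 2 * Real.exp (-1) * Real.exp (ε * w) := by positivity
    simp only [κ]
    linarith
  have hκ : ∀ w, 0 < κ w := fun w => lt_of_lt_of_le (by norm_num) (hκ4 w)
  have hμ : ∀ w, 0 ≤ μ w := fun w => Nat.cast_nonneg _
  -- The `7`: the exponential part of `4 * κ u` is at least `1 / 6` against the constant `1`, hence
  -- at least a seventh of the whole.
  have hκη : ∀ u w, u < w → (1 + ε / 7) * κ u ≤ κ w := fun u w h => by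
    have h1 : Real.exp (ε * u) * (1 + ε) ≤ Real.exp (ε * w) := by
      have h2 : ε * u + ε ≤ ε * w := by
        have : (u : ℝ) + 1 ≤ w := by exact_mod_cast h
        nlinarith
      calc Real.exp (ε * u) * (1 + ε) ≤ Real.exp (ε * u) * Real.exp ε := by
            refine mul_le_mul_of_nonneg_left ?_ (Real.exp_pos _).le
            linarith [Real.add_one_le_exp ε]
        _ = Real.exp (ε * u + ε) := (Real.exp_add _ _).symm
        _ ≤ _ := Real.exp_le_exp.2 h2
    have h3 : 1 / 3 ≤ Real.exp (-1) := by
      rw [Real.exp_neg, one_div]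
      exact inv_anti₀ (Real.exp_pos 1) (by linarith [Real.exp_one_lt_d9])
    have h4 : 1 ≤ Real.exp (ε * u) := Real.one_le_exp (by positivity)
    have h5 := mul_le_mul_of_nonneg_left h1 (Real.exp_pos (-1)).le
    have h6 : 1 / 3 ≤ Real.exp (-1) * Real.exp (ε * u) := by nlinarith
    simp only [κ]
    nlinarith
  have hsum1 : ∀ φ : ℕ → ℝ, ∑ i, ∑ j, φ (A i j) = ∑ w ∈ Finset.range (Δ + 1), μ w * φ w :=
    fun φ => sum_comp_eq_sum_card hA φ
  have hpos : ∃ w ≤ Δ, 0 < μ w := by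
    obtain ⟨i⟩ := ‹Nonempty I›
    obtain ⟨j⟩ := ‹Nonempty J›
    refine ⟨A i j, hA i j, Nat.cast_pos.2 (Finset.card_pos.2 ⟨(i, j), by simp⟩)⟩
  obtain ⟨T, hT, v, hvΔ, hdom⟩ := exists_dominant_value hT₀ (η := 1 + ε / 7) (by linarith)
    hμ hpos hκ hκη
  obtain ⟨R, C, hRC⟩ := ((isRectangleMixture_of_rank_le hΔ hr hA hrank).pow T)
    fun i j => if A i j = v then (1 : ℝ) else -K
  refine ⟨R, C, v, ?_⟩
  set f : ℕ → ℝ := fun w => μ w * κ w ^ T with hf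
  have hf0 : ∀ w, 0 ≤ f w := fun w => mul_nonneg (hμ w) (pow_pos (hκ w) _).le
  have hvmem : v ∈ Finset.range (Δ + 1) := by simpa [Nat.lt_succ_iff] using hvΔ
  have hη1 : 1 ≤ (1 + ε / 7) ^ T₀ := one_le_pow₀ (by linarith)
  have hlower : f v / 2 ≤ ∑ i ∈ R, ∑ j ∈ C, if A i j = v then (1 : ℝ) else -K := by
    refine le_trans ?_ hRC
    have h1 := hsum1 fun w => (if w = v then (1 : ℝ) else -K) * κ w ^ T
    refine le_of_le_of_eq ?_ h1.symm
    rw [← Finset.add_sum_erase _ _ hvmem]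
    have h2 : ∀ w ∈ (Finset.range (Δ + 1)).erase v,
        -(f v / (2 * Δ)) ≤ μ w * ((if w = v then (1 : ℝ) else -K) * κ w ^ T) := fun w hw => by
      have hwv := Finset.ne_of_mem_erase hw
      have hwΔ : w ≤ Δ := by simpa [Nat.lt_succ_iff] using Finset.mem_of_mem_erase hw
      rw [if_neg hwv]
      have h3 : 2 * K * Δ * f w ≤ f v :=
        (mul_le_mul_of_nonneg_right hKT (hf0 w)).trans (hdom w hwΔ hwv)
      have h4 : K * f w ≤ f v / (2 * Δ) := by
        rw [le_div_iff₀ (by positivity)]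
        linarith
      have h5 : μ w * (-K * κ w ^ T) = -(K * f w) := by simp only [hf]; ring
      rw [h5]
      linarith
    have h3 := Finset.card_nsmul_le_sum _ _ _ h2
    rw [Finset.card_erase_of_mem hvmem, Finset.card_range, Nat.add_sub_cancel, nsmul_eq_mul] at h3
    have h4 : (Δ : ℝ) * -(f v / (2 * Δ)) = -(f v / 2) := by field_simp
    rw [h4] at h3
    have h5 : μ v * ((if v = v then (1 : ℝ) else -K) * κ v ^ T) = f v := by simp [hf]
    rw [h5]
    linarith
  have hupper : (Fintype.card I * Fintype.card J : ℝ) ≤ (Δ + 1) * 4 ^ T * f v := by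
    have h1 : ((1 / 4 : ℝ) ^ T) * (Fintype.card I * Fintype.card J) ≤ ∑ i, ∑ j, κ (A i j) ^ T := by
      calc ((1 / 4 : ℝ) ^ T) * (Fintype.card I * Fintype.card J)
          = ∑ _i : I, ∑ _j : J, (1 / 4 : ℝ) ^ T := by simp; ring
        _ ≤ _ := Finset.sum_le_sum fun i _ => Finset.sum_le_sum fun j _ =>
            pow_le_pow_left₀ (by norm_num) (hκ4 _) _
    rw [hsum1 fun w => κ w ^ T] at h1
    have h2 : ∑ w ∈ Finset.range (Δ + 1), μ w * κ w ^ T ≤ (Δ + 1) * f v := by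
      have := Finset.sum_le_card_nsmul (Finset.range (Δ + 1)) f (f v) fun w hw => by
        by_cases hwv : w = v
        · rw [hwv]
        · refine le_trans ?_ (hdom w (by simpa [Nat.lt_succ_iff] using hw) hwv)
          exact le_mul_of_one_le_left (hf0 w) hη1
      simpa using this
    have h3 := h1.trans h2
    rw [one_div, inv_pow, inv_mul_le_iff₀ (by positivity)] at h3
    linarith
  have h4 : (4 : ℝ) ^ T ≤ 4 ^ ((2 * Δ + 1) * T₀) := pow_le_pow_right₀ (by norm_num) hT
  calc (Fintype.card I * Fintype.card J : ℝ) ≤ (Δ + 1) * 4 ^ T * f v := hupper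
    _ ≤ (Δ + 1) * 4 ^ ((2 * Δ + 1) * T₀) * f v := by
        gcongr
    _ = 2 * (Δ + 1) * 4 ^ ((2 * Δ + 1) * T₀) * (f v / 2) := by ring
    _ ≤ _ := by gcongr

theorem exists_spanning_rows (M : Matrix I J ℝ) (s : Finset I) :
    ∃ t ⊆ s, t.card ≤ M.rank ∧ ∀ i ∈ s, M.row i ∈ Submodule.span ℝ (M.row '' t) := by
  obtain ⟨b, hbs, -, hspan, hb⟩ := exists_linearIndepOn_extension
    (linearIndepOn_empty ℝ M.row) (Set.empty_subset (s : Set I))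
  have hfin : b.Finite := s.finite_toSet.subset hbs
  refine ⟨hfin.toFinset, fun i hi => hbs (hfin.mem_toFinset.1 hi), ?_, fun i hi => ?_⟩
  · have := hfin.fintype
    have h1 : Module.finrank ℝ (Submodule.span ℝ (Set.range fun i : b => M.row i)) =
      Fintype.card b := finrank_span_eq_card hb
    rw [M.rank_eq_finrank_span_row, Set.Finite.card_toFinset, ← h1]
    refine Submodule.finrank_mono (Submodule.span_mono ?_)
    rintro _ ⟨i, rfl⟩
    exact ⟨i, rfl⟩
  · rw [hfin.coe_toFinset]
    exact hspan ⟨i, hi, rfl⟩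

/-- By Markov, half of the rows have at most `|C| / (2r)` bad columns. At most `r` of these rows
span the others, and deleting their bad columns costs at most half of `C`. On the remaining columns
the spanning rows are constant, hence so is every kept row; its value is `v` because its bad columns
are too few to fill `C'`. -/
theorem exists_monochromatic_of_almost {r : ℕ} (hr : 2 ≤ r) {A : Matrix I J ℕ}
    (hrank : (A.map (Nat.cast : ℕ → ℝ)).rank ≤ r) {R : Finset I} {C : Finset J} {v : ℕ}
    (h : 0 < ∑ i ∈ R, ∑ j ∈ C, if A i j = v then (1 : ℝ) else -(4 * r)) :
    ∃ R' ⊆ R, ∃ C' ⊆ C, (∀ i ∈ R', ∀ j ∈ C', A i j = v) ∧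
      R.card * C.card ≤ 4 * (R'.card * C'.card) := by
  classical
  let bad : I → Finset J := fun i => C.filter fun j => A i j ≠ v
  have hr0 : (0 : ℝ) < r := by positivity
  have hrow : ∀ i, ∑ j ∈ C, (if A i j = v then (1 : ℝ) else -(4 * r)) =
      C.card - (4 * r + 1) * (bad i).card := fun i => by
    rw [Finset.sum_ite, Finset.sum_const, Finset.sum_const, nsmul_eq_mul, nsmul_eq_mul]
    have := Finset.card_filter_add_card_filter_not (s := C) (fun j => A i j = v)
    have h2 : ((C.filter fun j => A i j = v).card : ℝ) + (bad i).card = C.card := by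
      exact_mod_cast this
    have h3 : ((C.filter fun j => ¬ A i j = v).card : ℝ) = (bad i).card := rfl
    rw [h3]
    linarith
  simp only [hrow] at h
  rw [Finset.sum_sub_distrib, Finset.sum_const, nsmul_eq_mul, ← Finset.mul_sum] at h
  have hCpos : 0 < C.card := by
    by_contra! hc
    have h0 : C = ∅ := Finset.card_eq_zero.1 (by omega)
    have : ∀ i, (bad i).card = 0 := fun i => by simp [bad, h0]
    simp [this, h0] at h
  have hCpos' : (0 : ℝ) < C.card := by exact_mod_cast hCpos
  let R' := R.filter fun i => 2 * r * (bad i).card ≤ C.card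
  have hR' : R.card ≤ 2 * R'.card := by
    have h1 : ∑ i ∈ R.filter (fun i => ¬ 2 * r * (bad i).card ≤ C.card), (C.card : ℝ) / (2 * r) ≤
        ∑ i ∈ R, ((bad i).card : ℝ) := by
      refine (Finset.sum_le_sum (fun i hi => ?_)).trans
        (Finset.sum_le_sum_of_subset_of_nonneg (Finset.filter_subset _ _)
          fun i _ _ => Nat.cast_nonneg _)
      have h2 := (Finset.mem_filter.1 hi).2
      rw [div_le_iff₀ (by positivity)]
      have h3 : (C.card : ℝ) ≤ 2 * r * (bad i).card := by exact_mod_cast (not_le.1 h2).le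
      linarith
    rw [Finset.sum_const, nsmul_eq_mul] at h1
    have h2 : (R'.card : ℝ) + (R.filter (fun i => ¬ 2 * r * (bad i).card ≤ C.card)).card =
        R.card := by
      exact_mod_cast Finset.card_filter_add_card_filter_not (s := R)
        (fun i => 2 * r * (bad i).card ≤ C.card)
    set y : ℝ := ((R.filter (fun i => ¬ 2 * r * (bad i).card ≤ C.card)).card : ℝ)
    have hB0 : 0 ≤ ∑ i ∈ R, ((bad i).card : ℝ) := Finset.sum_nonneg fun i _ => Nat.cast_nonneg _
    have h3 : 4 * r * (y * (C.card / (2 * r))) ≤ R.card * C.card := by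
      have := mul_le_mul_of_nonneg_left h1 (by positivity : (0 : ℝ) ≤ 4 * r)
      linarith
    have h4 : 4 * r * (y * (C.card / (2 * r))) = 2 * y * C.card := by field_simp; ring
    rw [h4] at h3
    have h5 : 2 * y ≤ R.card := le_of_mul_le_mul_right h3 hCpos'
    have h6 : (R.card : ℝ) ≤ 2 * R'.card := by linarith
    exact_mod_cast h6
  obtain ⟨t, htR, htcard, htspan⟩ := exists_spanning_rows (A.map (Nat.cast : ℕ → ℝ)) R'
  let C' := C.filter fun j => ∀ i ∈ t, A i j = v
  have hC' : C.card ≤ 2 * C'.card := by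
    have h1 : C.filter (fun j => ¬ ∀ i ∈ t, A i j = v) ⊆ t.biUnion bad := fun j hj => by
      obtain ⟨hjC, hj⟩ := Finset.mem_filter.1 hj
      push Not at hj
      obtain ⟨i, hi, hij⟩ := hj
      exact Finset.mem_biUnion.2 ⟨i, hi, Finset.mem_filter.2 ⟨hjC, hij⟩⟩
    have h2 := (Finset.card_le_card h1).trans Finset.card_biUnion_le
    have h3 : 2 * r * ∑ i ∈ t, (bad i).card ≤ r * C.card := by
      rw [Finset.mul_sum]
      refine (Finset.sum_le_card_nsmul t _ C.card fun i hi =>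
        (Finset.mem_filter.1 (htR hi)).2).trans ?_
      rw [smul_eq_mul]
      exact Nat.mul_le_mul_right _ (htcard.trans hrank)
    have h4 : 2 * ∑ i ∈ t, (bad i).card ≤ C.card := by
      refine le_of_mul_le_mul_left (a := r) ?_ (by omega)
      linarith
    have h5 := Finset.card_filter_add_card_filter_not (s := C) (fun j => ∀ i ∈ t, A i j = v)
    have h6 : C'.card + (C.filter (fun j => ¬ ∀ i ∈ t, A i j = v)).card = C.card := h5
    omega
  refine ⟨R', Finset.filter_subset _ _, C', Finset.filter_subset _ _, fun i hi j hj => ?_, ?_⟩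
  · obtain ⟨j₀, hj₀, hij₀⟩ : ∃ j₀ ∈ C', A i j₀ = v := by
      by_contra! hcon
      have h1 : C' ⊆ bad i := fun j hj =>
        Finset.mem_filter.2 ⟨(Finset.mem_filter.1 hj).1, hcon j hj⟩
      have h2 := Finset.card_le_card h1
      have h3 := (Finset.mem_filter.1 hi).2
      have h4 : 4 * (bad i).card ≤ 2 * r * (bad i).card := Nat.mul_le_mul_right _ (by omega)
      omega
    have h1 := eq_of_mem_span_rows (M := A.map (Nat.cast : ℕ → ℝ)) (t := t) (j := j) (j' := j₀)
      (fun k hk => by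
        have e1 := (Finset.mem_filter.1 hj).2 k hk
        have e2 := (Finset.mem_filter.1 hj₀).2 k hk
        simp [e1, e2]) (htspan i hi)
    have h2 : (A i j : ℝ) = A i j₀ := h1
    rw [← hij₀]
    exact_mod_cast h2
  · calc R.card * C.card ≤ (2 * R'.card) * (2 * C'.card) := Nat.mul_le_mul hR' hC'
      _ = _ := by ring

/-- A matrix of rank at most `r` with entries in `{0, …, Δ}` has a large monochromatic
rectangle. -/
theorem exists_monochromatic_rectangle [Nonempty I] [Nonempty J] {Δ r T₀ : ℕ} (hΔ : 0 < Δ)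
    (hr : 2 ≤ r) (hT₀ : 0 < T₀) (hT : (8 * r * Δ : ℝ) ≤ (1 + 1 / (Δ * √r) / 7) ^ T₀)
    {A : Matrix I J ℕ} (hA : ∀ i j, A i j ≤ Δ) (hrank : (A.map (Nat.cast : ℕ → ℝ)).rank ≤ r) :
    ∃ (R : Finset I) (C : Finset J) (v : ℕ), (∀ i ∈ R, ∀ j ∈ C, A i j = v) ∧
      Fintype.card I * Fintype.card J ≤
        8 * (Δ + 1) * 4 ^ ((2 * Δ + 1) * T₀) * (R.card * C.card) := by
  obtain ⟨R, C, v, h⟩ := exists_almost_monochromatic hΔ (by omega) hT₀ hA hrank (K := 4 * r)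
    (by linarith)
  have hpos : (0 : ℝ) < Fintype.card I * Fintype.card J := by
    have := Fintype.card_pos (α := I)
    have := Fintype.card_pos (α := J)
    positivity
  have hsum : 0 < ∑ i ∈ R, ∑ j ∈ C, if A i j = v then (1 : ℝ) else -(4 * r) :=
    pos_of_mul_pos_right (hpos.trans_le h) (by positivity)
  obtain ⟨R', -, C', -, hmono, hcard⟩ := exists_monochromatic_of_almost hr hrank hsum
  refine ⟨R', C', v, hmono, ?_⟩
  have h1 : ∑ i ∈ R, ∑ j ∈ C, (if A i j = v then (1 : ℝ) else -(4 * r)) ≤ R.card * C.card := by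
    calc _ ≤ ∑ i ∈ R, ∑ j ∈ C, (1 : ℝ) := Finset.sum_le_sum fun i _ => Finset.sum_le_sum fun j _ => by
          split_ifs
          · exact le_rfl
          · have : (0 : ℝ) ≤ r := Nat.cast_nonneg r
            linarith
      _ = _ := by simp
  have h2 : (R.card * C.card : ℝ) ≤ 4 * (R'.card * C'.card) := by exact_mod_cast hcard
  have h3 : (Fintype.card I * Fintype.card J : ℝ) ≤
      8 * (Δ + 1) * 4 ^ ((2 * Δ + 1) * T₀) * (R'.card * C'.card) := by
    calc _ ≤ _ := h
      _ ≤ 2 * (Δ + 1) * 4 ^ ((2 * Δ + 1) * T₀) * (4 * (R'.card * C'.card)) := by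
          gcongr
          exact h1.trans h2
      _ = _ := by ring
  exact_mod_cast h3

end Rectangles

/-! ### From monochromatic rectangles to nonnegative rank -/

section NonnegRank

variable {I J : Type*}

theorem NonnegRankLE.mono {M : Matrix I J ℝ} {N N' : ℕ} (h : NonnegRankLE M N) (hN : N ≤ N') :
    NonnegRankLE M N' := by
  obtain ⟨k, rfl⟩ := Nat.exists_eq_add_of_le hN
  obtain ⟨u, w, hu, hw, h⟩ := h
  refine ⟨Fin.append u fun _ _ => 0, Fin.append w fun _ _ => 0, fun k => ?_, fun k => ?_,
    fun i j => ?_⟩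
  · induction k using Fin.addCases <;> simp [hu]
  · induction k using Fin.addCases <;> simp [hw]
  · simp [Fin.sum_univ_add, h]

theorem NonnegRankLE.add {M M' : Matrix I J ℝ} {N N' : ℕ} (h : NonnegRankLE M N)
    (h' : NonnegRankLE M' N') : NonnegRankLE (M + M') (N + N') := by
  obtain ⟨u, w, hu, hw, h⟩ := h
  obtain ⟨u', w', hu', hw', h'⟩ := h'
  refine ⟨Fin.append u u', Fin.append w w', fun k => ?_, fun k => ?_, fun i j => ?_⟩
  · induction k using Fin.addCases <;> simp [hu, hu']
  · induction k using Fin.addCases <;> simp [hw, hw']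
  · simp [Fin.sum_univ_add, h, h']

theorem NonnegRankLE.submatrix {M : Matrix I J ℝ} {N : ℕ} (h : NonnegRankLE M N) {I' J' : Type*}
    (f : I' → I) (g : J' → J) : NonnegRankLE (M.submatrix f g) N := by
  obtain ⟨u, w, hu, hw, h⟩ := h
  exact ⟨fun k i => u k (f i), fun k j => w k (g j), fun k i => hu k _, fun k j => hw k _,
    fun i j => h _ _⟩

/-- The restriction of a matrix to a rectangle, extended by zero. -/
def restrictRectangle (M : Matrix I J ℝ) (p : I → Prop) (q : J → Prop) [DecidablePred p]
    [DecidablePred q] : Matrix I J ℝ :=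
  fun i j => if p i ∧ q j then M i j else 0

theorem NonnegRankLE.restrictRectangle {M : Matrix I J ℝ} {p : I → Prop} {q : J → Prop}
    [DecidablePred p] [DecidablePred q] {N : ℕ}
    (h : NonnegRankLE (M.submatrix (Subtype.val : {i // p i} → I) (Subtype.val : {j // q j} → J)) N) :
    NonnegRankLE (restrictRectangle M p q) N := by
  obtain ⟨u, w, hu, hw, h⟩ := h
  refine ⟨fun k i => if hi : p i then u k ⟨i, hi⟩ else 0,
    fun k j => if hj : q j then w k ⟨j, hj⟩ else 0, fun k i => ?_, fun k j => ?_, fun i j => ?_⟩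
  · dsimp only
    split_ifs
    exacts [hu _ _, le_rfl]
  · dsimp only
    split_ifs
    exacts [hw _ _, le_rfl]
  · by_cases hi : p i <;> by_cases hj : q j <;> simp [_root_.restrictRectangle, hi, hj]
    exact h ⟨i, hi⟩ ⟨j, hj⟩

theorem nonnegRankLE_const {c : ℝ} (hc : 0 ≤ c) {M : Matrix I J ℝ} (h : ∀ i j, M i j = c) :
    NonnegRankLE M 1 :=
  ⟨fun _ _ => c, fun _ _ => 1, fun _ _ => hc, fun _ _ => zero_le_one, fun i j => by simp [h]⟩

theorem nonnegRankLE_zero_of_isEmpty {M : Matrix I J ℝ} (h : IsEmpty I ∨ IsEmpty J) :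
    NonnegRankLE M 0 :=
  ⟨fun _ _ => 0, fun _ _ => 0, fun _ _ => le_rfl, fun _ _ => le_rfl, fun i j => by
    rcases h with h | h
    exacts [h.elim i, h.elim j]⟩

/-- A rank factorization has at most one term here, so absolute values can be taken factor by
factor. -/
theorem nonnegRankLE_one_of_rank_le_one [Fintype I] [Fintype J] {M : Matrix I J ℝ}
    (hM : ∀ i j, 0 ≤ M i j) (hr : M.rank ≤ 1) : NonnegRankLE M 1 := by
  obtain ⟨u, v, huv⟩ := exists_rank_factorization M
  have key : NonnegRankLE M M.rank := by
    refine ⟨fun k i => |u i k|, fun k j => |v k j|, fun _ _ => abs_nonneg _,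
      fun _ _ => abs_nonneg _, fun i j => ?_⟩
    have h1 : M i j = ∑ k, u i k * v k j := by
      conv_lhs => rw [huv]
      rfl
    have hsub : Subsingleton (Fin M.rank) := Fin.subsingleton_iff_le_one.2 hr
    rw [← abs_of_nonneg (hM i j), h1]
    simp only [← abs_mul]
    by_cases hne : Nonempty (Fin M.rank)
    · obtain ⟨k⟩ := hne
      rw [Fintype.sum_subsingleton _ k, Fintype.sum_subsingleton _ k]
    · rw [not_nonempty_iff] at hne
      simp
  exact key.mono hr

end NonnegRank

/-! ### Ranks of the blocks around a constant rectangle, and the number of distinct rows. -/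

section Rank

variable {I J : Type*} [Fintype I] [Fintype J]

/-- Rank-nullity for the restriction of the row space to the columns in `q`: the rows in `p` lie in
the kernel, and the other rows span the image of their restrictions. -/
theorem rank_add_rank_le_of_zero_block (M : Matrix I J ℝ) (p : I → Prop) (q : J → Prop)
    [DecidablePred p] [DecidablePred q] (h : ∀ i j, p i → q j → M i j = 0) :
    (M.submatrix (Subtype.val : {i // p i} → I) (Subtype.val : {j // ¬ q j} → J)).rank +
      (M.submatrix (Subtype.val : {i // ¬ p i} → I) (Subtype.val : {j // q j} → J)).rank ≤
      M.rank := by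
  set W := Submodule.span ℝ (Set.range M.row) with hW
  have hmem : ∀ i, M.row i ∈ W := fun i => Submodule.subset_span ⟨i, rfl⟩
  let φ : W →ₗ[ℝ] ({j // q j} → ℝ) := (LinearMap.funLeft ℝ ℝ Subtype.val).domRestrict W
  let ψ : LinearMap.ker φ →ₗ[ℝ] ({j // ¬ q j} → ℝ) :=
    (LinearMap.funLeft ℝ ℝ Subtype.val) ∘ₗ W.subtype ∘ₗ (LinearMap.ker φ).subtype
  have h1 : (M.submatrix (Subtype.val : {i // ¬ p i} → I) (Subtype.val : {j // q j} → J)).rank ≤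
      Module.finrank ℝ (LinearMap.range φ) := by
    rw [Matrix.rank_eq_finrank_span_row]
    refine Submodule.finrank_mono (Submodule.span_le.2 ?_)
    rintro _ ⟨i, rfl⟩
    exact ⟨⟨M.row i, hmem i⟩, rfl⟩
  have h2 : (M.submatrix (Subtype.val : {i // p i} → I) (Subtype.val : {j // ¬ q j} → J)).rank ≤
      Module.finrank ℝ (LinearMap.ker φ) := by
    rw [Matrix.rank_eq_finrank_span_row]
    refine (Submodule.finrank_mono (t := LinearMap.range ψ) (Submodule.span_le.2 ?_)).trans
      (LinearMap.finrank_range_le ψ)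
    rintro _ ⟨i, rfl⟩
    refine ⟨⟨⟨M.row i, hmem i⟩, ?_⟩, rfl⟩
    rw [LinearMap.mem_ker]
    ext j
    exact h i j i.2 j.2
  have h3 := φ.finrank_range_add_finrank_ker
  rw [M.rank_eq_finrank_span_row, ← hW]
  omega

/-- A rank-one correction supported on the block reduces to the zero case and costs one. -/
theorem rank_add_rank_le_of_const_block (M : Matrix I J ℝ) (p : I → Prop) (q : J → Prop)
    [DecidablePred p] [DecidablePred q] {c : ℝ} (h : ∀ i j, p i → q j → M i j = c) :
    (M.submatrix (Subtype.val : {i // p i} → I) (Subtype.val : {j // ¬ q j} → J)).rank +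
      (M.submatrix (Subtype.val : {i // ¬ p i} → I) (Subtype.val : {j // q j} → J)).rank ≤
      M.rank + 1 := by
  set Z := Matrix.vecMulVec (fun i => if p i then -c else 0) (fun j => if q j then (1 : ℝ) else 0)
    with hZ
  have h0 := rank_add_rank_le_of_zero_block (M + Z) p q fun i j hi hj => by
    simp [hZ, Matrix.vecMulVec_apply, hi, hj, h i j hi hj]
  have h1 : (M + Z).submatrix (Subtype.val : {i // p i} → I) (Subtype.val : {j // ¬ q j} → J) =
      M.submatrix Subtype.val Subtype.val := by
    ext i j
    simp [hZ, Matrix.vecMulVec_apply, j.2]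
  have h2 : (M + Z).submatrix (Subtype.val : {i // ¬ p i} → I) (Subtype.val : {j // q j} → J) =
      M.submatrix Subtype.val Subtype.val := by
    ext i j
    simp [hZ, Matrix.vecMulVec_apply, i.2]
  rw [h1, h2] at h0
  have h3 : (M + Z).rank ≤ M.rank + Z.rank := by
    unfold Matrix.rank
    rw [Matrix.mulVecLin_add]
    refine (Submodule.finrank_mono (LinearMap.range_add_le _ _)).trans ?_
    exact Submodule.finrank_add_le_finrank_add_finrank _ _
  have h4 : Z.rank ≤ 1 := Matrix.rank_vecMulVec_le _ _
  omega

/-- A row is determined by its entries in a set of columns spanning the column space. -/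
theorem exists_row_representatives {Δ : ℕ} {A : Matrix I J ℕ} (hA : ∀ i j, A i j ≤ Δ) :
    ∃ s : Finset I, s.card ≤ (Δ + 1) ^ (A.map (Nat.cast : ℕ → ℝ)).rank ∧
      ∀ i, ∃ i' ∈ s, A i = A i' := by
  classical
  obtain ⟨t, -, htcard, ht⟩ := exists_spanning_rows (A.map (Nat.cast : ℕ → ℝ)).transpose
    Finset.univ
  rw [Matrix.rank_transpose] at htcard
  let Φ : I → t → Fin (Δ + 1) := fun i j => ⟨A i j, Nat.lt_succ_iff.2 (hA i j)⟩
  have hΦ : ∀ i i', Φ i = Φ i' → A i = A i' := fun i i' h => by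
    ext j
    have h1 := eq_of_mem_span_rows (M := (A.map (Nat.cast : ℕ → ℝ)).transpose) (t := t)
      (j := i) (j' := i') (fun k hk => by
        have := congrArg Fin.val (congrFun h ⟨k, hk⟩)
        have h2 : A i k = A i' k := this
        simp [h2]) (ht j (Finset.mem_univ j))
    have h2 : (A i j : ℝ) = A i' j := h1
    exact_mod_cast h2
  choose σ hσ using fun x : (Finset.univ.image Φ) => Finset.mem_image.1 x.2
  refine ⟨Finset.univ.image σ, ?_, fun i => ⟨σ ⟨Φ i, by simp⟩, by simp, ?_⟩⟩
  · refine Finset.card_image_le.trans ?_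
    rw [Finset.card_univ, Fintype.card_coe]
    refine (Finset.card_le_univ _).trans ?_
    rw [Fintype.card_fun, Fintype.card_fin, Fintype.card_coe]
    exact Nat.pow_le_pow_right (by omega) htcard
  · exact hΦ _ _ (hσ ⟨Φ i, by simp⟩).2.symm

end Rank

/-! ### The recursion on the rank. -/

/-- Every matrix of rank at most `r` with entries in `{0, …, Δ}` has nonnegative rank at
most `N`. -/
def NonnegRankBound (Δ r N : ℕ) : Prop :=
  ∀ (I J : Type) [Fintype I] [Fintype J] (A : Matrix I J ℕ), (∀ i j, A i j ≤ Δ) →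
    (A.map (Nat.cast : ℕ → ℝ)).rank ≤ r → NonnegRankLE (A.map (Nat.cast : ℕ → ℝ)) N

/-- Every nonempty matrix of rank at most `r` with entries in `{0, …, Δ}` has a
monochromatic rectangle covering a `1 / D` fraction of its entries. -/
def RectangleBound (Δ r D : ℕ) : Prop :=
  ∀ (I J : Type) [Fintype I] [Fintype J] [Nonempty I] [Nonempty J] (A : Matrix I J ℕ),
    (∀ i j, A i j ≤ Δ) → (A.map (Nat.cast : ℕ → ℝ)).rank ≤ r →
    ∃ (R : Finset I) (C : Finset J) (v : ℕ), (∀ i ∈ R, ∀ j ∈ C, A i j = v) ∧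
      Fintype.card I * Fintype.card J ≤ D * (R.card * C.card)

theorem nonnegRankBound_of_rank_le_one {Δ r : ℕ} (hr : r ≤ 1) : NonnegRankBound Δ r 1 :=
  fun _ _ _ _ _ _ hrank => nonnegRankLE_one_of_rank_le_one (fun _ _ => by simp) (hrank.trans hr)

/-- Removing a `1 / D` fraction of the entries uses up one factor `(D - 1) / D` of the budget. -/
theorem shrink_step {D s m m' k : ℕ} (hD : 0 < D) (hm : m ≤ D * k) (hm' : m' + k ≤ m)
    (h : m * (D - 1) ^ (s + 1) < D ^ (s + 1)) : m' * (D - 1) ^ s < D ^ s := by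
  obtain ⟨E, rfl⟩ : ∃ E, D = E + 1 := ⟨D - 1, by omega⟩
  simp only [Nat.add_sub_cancel] at h ⊢
  have h1 : (E + 1) * m' ≤ m * E := by nlinarith
  refine lt_of_mul_lt_mul_left (a := E + 1) ?_ (by omega)
  calc (E + 1) * (m' * E ^ s) = (E + 1) * m' * E ^ s := by ring
    _ ≤ m * E * E ^ s := Nat.mul_le_mul_right _ h1
    _ = m * E ^ (s + 1) := by ring
    _ < (E + 1) ^ (s + 1) := h
    _ = _ := by ring

/-- Splitting off monochromatic rectangles one after the other. -/
theorem nonnegRankLE_of_card_lt {Δ r D N : ℕ} (hD : 0 < D) (hrect : RectangleBound Δ r D)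
    (hN : NonnegRankBound Δ ((r + 1) / 2) N) (s : ℕ) :
    ∀ (I J : Type) [Fintype I] [Fintype J] (A : Matrix I J ℕ), (∀ i j, A i j ≤ Δ) →
      (A.map (Nat.cast : ℕ → ℝ)).rank ≤ r →
      Fintype.card I * Fintype.card J * (D - 1) ^ s < D ^ s →
      NonnegRankLE (A.map (Nat.cast : ℕ → ℝ)) (s * (1 + N)) := by
  classical
  induction s with
  | zero =>
    intro I J _ _ A hA hrank hcard
    have h0 : Fintype.card I * Fintype.card J = 0 := by simpa using hcard
    rw [zero_mul]
    refine nonnegRankLE_zero_of_isEmpty ?_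
    rcases Nat.mul_eq_zero.1 h0 with h | h
    · exact Or.inl (Fintype.card_eq_zero_iff.1 h)
    · exact Or.inr (Fintype.card_eq_zero_iff.1 h)
  | succ s ih =>
    intro I J _ _ A hA hrank hcard
    by_cases hI : IsEmpty I
    · exact (nonnegRankLE_zero_of_isEmpty (Or.inl hI)).mono (Nat.zero_le _)
    by_cases hJ : IsEmpty J
    · exact (nonnegRankLE_zero_of_isEmpty (Or.inr hJ)).mono (Nat.zero_le _)
    rw [not_isEmpty_iff] at hI hJ
    obtain ⟨R, C, v, hmono, hRC⟩ := hrect I J A hA hrank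
    set M := A.map (Nat.cast : ℕ → ℝ) with hM
    have hblock : (M.submatrix (Subtype.val : {i // i ∈ R} → I)
        (Subtype.val : {j // j ∉ C} → J)).rank + (M.submatrix (Subtype.val : {i // i ∉ R} → I)
        (Subtype.val : {j // j ∈ C} → J)).rank ≤ M.rank + 1 := by
      convert rank_add_rank_le_of_const_block M (· ∈ R) (· ∈ C) (c := v)
        fun i j hi hj => by simp [hM, hmono i hi j hj]
    have hconst : NonnegRankLE (restrictRectangle M (· ∈ R) (· ∈ C)) 1 :=
      NonnegRankLE.restrictRectangle (nonnegRankLE_const (c := v) (Nat.cast_nonneg v)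
        fun i j => by simp [hM, hmono i i.2 j j.2])
    have hRle : R.card ≤ Fintype.card I := Finset.card_le_univ R
    have hCle : C.card ≤ Fintype.card J := Finset.card_le_univ C
    have hRc : Fintype.card {i // i ∉ R} = Fintype.card I - R.card := by
      rw [Fintype.card_subtype_compl]
      simp
    have hCc : Fintype.card {j // j ∉ C} = Fintype.card J - C.card := by
      rw [Fintype.card_subtype_compl]
      simp
    have hfinal : (s + 1) * (1 + N) = 1 + N + s * (1 + N) := by ring
    rw [hfinal]
    -- The two off-diagonal ranks sum to at most `r + 1`, so one is at most `(r + 1) / 2`. That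
    -- block goes to `hN`, and the rows outside `R`, or the columns outside `C`, go to the next
    -- round.
    rcases le_or_gt (M.submatrix (Subtype.val : {i // i ∈ R} → I)
      (Subtype.val : {j // j ∉ C} → J)).rank ((r + 1) / 2) with hle | hgt
    · have h1 : NonnegRankLE (restrictRectangle M (· ∈ R) (· ∉ C)) N :=
        NonnegRankLE.restrictRectangle (hN _ _ (A.submatrix Subtype.val Subtype.val)
          (fun i j => hA _ _) hle)
      have h2 : NonnegRankLE (restrictRectangle M (· ∉ R) (fun _ => True)) (s * (1 + N)) := by
        refine NonnegRankLE.restrictRectangle (ih _ _ (A.submatrix Subtype.val Subtype.val)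
          (fun i j => hA _ _) ((Matrix.rank_submatrix_le M _ _).trans hrank)
          (shrink_step hD hRC ?_ hcard))
        rw [hRc, Fintype.card_subtype_true]
        obtain ⟨k, hk⟩ := Nat.exists_eq_add_of_le hRle
        rw [hk, Nat.add_sub_cancel_left]
        nlinarith
      have h := (hconst.add h1).add h2
      convert h using 1
      ext i j
      by_cases hi : i ∈ R <;> by_cases hj : j ∈ C <;> simp [restrictRectangle, hi, hj]
    · have hle : (M.submatrix (Subtype.val : {i // i ∉ R} → I)
          (Subtype.val : {j // j ∈ C} → J)).rank ≤ (r + 1) / 2 := by omega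
      have h1 : NonnegRankLE (restrictRectangle M (· ∉ R) (· ∈ C)) N :=
        NonnegRankLE.restrictRectangle (hN _ _ (A.submatrix Subtype.val Subtype.val)
          (fun i j => hA _ _) hle)
      have h2 : NonnegRankLE (restrictRectangle M (fun _ => True) (· ∉ C)) (s * (1 + N)) := by
        refine NonnegRankLE.restrictRectangle (ih _ _ (A.submatrix Subtype.val Subtype.val)
          (fun i j => hA _ _) ((Matrix.rank_submatrix_le M _ _).trans hrank)
          (shrink_step hD hRC ?_ hcard))
        rw [hCc, Fintype.card_subtype_true]
        obtain ⟨k, hk⟩ := Nat.exists_eq_add_of_le hCle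
        rw [hk, Nat.add_sub_cancel_left]
        nlinarith
      have h := (hconst.add h1).add h2
      convert h using 1
      ext i j
      by_cases hi : i ∈ R <;> by_cases hj : j ∈ C <;> simp [restrictRectangle, hi, hj]

/-- Repeated rows and columns do not affect the factorization, so only `(Δ + 1) ^ (2 * r)` entries
have to be exhausted. -/
theorem nonnegRankBound_step {Δ r D N s : ℕ} (hD : 0 < D) (hrect : RectangleBound Δ r D)
    (hN : NonnegRankBound Δ ((r + 1) / 2) N)
    (hs : (Δ + 1) ^ (2 * r) * (D - 1) ^ s < D ^ s) :
    NonnegRankBound Δ r (s * (1 + N)) := by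
  intro I J _ _ A hA hrank
  obtain ⟨t, htcard, ht⟩ := exists_row_representatives hA
  obtain ⟨t', htcard', ht'⟩ := exists_row_representatives (A := A.transpose) fun i j => hA j i
  rw [Matrix.transpose_map, Matrix.rank_transpose] at htcard'
  choose σ hσ hσA using ht
  choose σ' hσ' hσA' using ht'
  have hsub := (Matrix.rank_submatrix_le (A.map (Nat.cast : ℕ → ℝ)) (Subtype.val : t → I)
    (Subtype.val : t' → J)).trans hrank
  have hb : 1 ≤ Δ + 1 := by omega
  have key := nonnegRankLE_of_card_lt hD hrect hN s t t' (A.submatrix Subtype.val Subtype.val)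
    (fun i j => hA _ _) hsub (by
      refine lt_of_le_of_lt (Nat.mul_le_mul_right _ ?_) hs
      rw [Fintype.card_coe, Fintype.card_coe, two_mul, pow_add]
      exact Nat.mul_le_mul (htcard.trans (Nat.pow_le_pow_right hb hrank))
        (htcard'.trans (Nat.pow_le_pow_right hb hrank)))
  convert key.submatrix (fun i => (⟨σ i, hσ i⟩ : t)) (fun j => (⟨σ' j, hσ' j⟩ : t')) using 1
  ext i j
  have h1 : A i j = A (σ i) j := congrFun (hσA i) j
  have h2 : A (σ i) j = A (σ i) (σ' j) := congrFun (hσA' j) (σ i)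
  simp [h1, h2]

/-! ### Quantitative bounds -/

/-- The number of repetitions of the rounding step. -/
noncomputable def roundingCount (Δ r : ℕ) : ℕ := ⌈14 * Δ * √r * Real.log (8 * r * Δ)⌉₊

/-- The inverse of the density of the monochromatic rectangles. -/
noncomputable def rectangleDensityInv (Δ r : ℕ) : ℕ :=
  8 * (Δ + 1) * 4 ^ ((2 * Δ + 1) * roundingCount Δ r)

theorem one_lt_eight_mul {Δ r : ℕ} (hΔ : 0 < Δ) (hr : 0 < r) : (1 : ℝ) < 8 * r * Δ := by
  have h1 : (1 : ℝ) ≤ Δ := by exact_mod_cast hΔ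
  have h2 : (1 : ℝ) ≤ r := by exact_mod_cast hr
  nlinarith

theorem roundingCount_pos {Δ r : ℕ} (hΔ : 0 < Δ) (hr : 0 < r) : 0 < roundingCount Δ r := by
  have h3 := Real.log_pos (one_lt_eight_mul hΔ hr)
  have h4 : (0 : ℝ) < √r := Real.sqrt_pos.2 (by exact_mod_cast hr)
  exact Nat.ceil_pos.2 (by positivity)

theorem exp_half_le_one_add {x : ℝ} (h0 : 0 ≤ x) (h1 : x ≤ 1) : Real.exp (x / 2) ≤ 1 + x := by
  have h2 := Real.one_sub_le_exp_neg (x / 2)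
  have h3 : Real.exp (x / 2) * Real.exp (-(x / 2)) = 1 := by
    rw [← Real.exp_add]
    simp
  have h4 : Real.exp (x / 2) * (1 - x / 2) ≤ 1 :=
    (mul_le_mul_of_nonneg_left h2 (Real.exp_pos _).le).trans h3.le
  nlinarith [Real.exp_pos (x / 2)]

/-- With `x = 1 / (7 * Δ * √r)`, the bound `exp (x / 2) ≤ 1 + x` requires `2 / x = 14 * Δ * √r`
times the logarithm of the target. -/
theorem le_pow_roundingCount {Δ r : ℕ} (hΔ : 0 < Δ) (hr : 0 < r) :
    (8 * r * Δ : ℝ) ≤ (1 + 1 / (Δ * √r) / 7) ^ roundingCount Δ r := by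
  have hΔ1 : (1 : ℝ) ≤ Δ := by exact_mod_cast hΔ
  have hr1 : (1 : ℝ) ≤ √r := Real.one_le_sqrt.2 (by exact_mod_cast hr)
  have hpos : 0 < (Δ : ℝ) * √r := by positivity
  have hx1 : 1 / ((Δ : ℝ) * √r) / 7 ≤ 1 := by
    have : 1 / ((Δ : ℝ) * √r) ≤ 1 := by
      rw [div_le_one hpos]
      nlinarith
    linarith
  have h1 := exp_half_le_one_add (by positivity) hx1
  refine le_trans ?_ (pow_le_pow_left₀ (Real.exp_pos _).le h1 _)
  rw [← Real.exp_nat_mul, ← Real.log_le_iff_le_exp (by linarith [one_lt_eight_mul hΔ hr])]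
  have h2 : 14 * Δ * √r * Real.log (8 * r * Δ) ≤ roundingCount Δ r := Nat.le_ceil _
  have h3 : Real.log (8 * r * Δ) =
      14 * Δ * √r * Real.log (8 * r * Δ) * (1 / ((Δ : ℝ) * √r) / 7 / 2) := by
    field_simp
    ring
  rw [h3]
  exact mul_le_mul_of_nonneg_right h2 (by positivity)

theorem rectangleBound_rectangleDensityInv {Δ r : ℕ} (hΔ : 0 < Δ) (hr : 2 ≤ r) :
    RectangleBound Δ r (rectangleDensityInv Δ r) := fun _ _ _ _ _ _ _ hA hrank =>
  exists_monochromatic_rectangle hΔ hr (roundingCount_pos hΔ (by omega))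
    (le_pow_roundingCount hΔ (by omega)) hA hrank

/-- `(1 - 1 / D) ^ D ≤ exp (-1)` and `a < exp a`. -/
theorem pow_mul_pow_lt_pow {a r D : ℕ} (hr : 0 < r) (hD : 0 < D) :
    a ^ (2 * r) * (D - 1) ^ (2 * r * a * D) < D ^ (2 * r * a * D) := by
  have hD' : (0 : ℝ) < D := by exact_mod_cast hD
  have h1 : (a : ℝ) ^ (2 * r) < Real.exp a ^ (2 * r) :=
    pow_lt_pow_left₀ (by linarith [Real.add_one_le_exp (a : ℝ)]) (Nat.cast_nonneg _) (by omega)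
  have h2 : ((D - 1 : ℕ) : ℝ) ≤ D * Real.exp (-(1 / D)) := by
    rw [Nat.cast_sub hD, Nat.cast_one]
    calc (D : ℝ) - 1 = D * (1 - 1 / D) := by field_simp
      _ ≤ _ := mul_le_mul_of_nonneg_left (Real.one_sub_le_exp_neg _) hD'.le
  have h3 := pow_le_pow_left₀ (Nat.cast_nonneg _) h2 (2 * r * a * D)
  have h4 : Real.exp a ^ (2 * r) * (D * Real.exp (-(1 / D))) ^ (2 * r * a * D) =
      (D : ℝ) ^ (2 * r * a * D) := by
    rw [mul_pow, ← Real.exp_nat_mul, ← Real.exp_nat_mul, mul_left_comm, ← Real.exp_add]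
    have : ((2 * r : ℕ) : ℝ) * a + ((2 * r * a * D : ℕ) : ℝ) * -(1 / (D : ℝ)) = 0 := by
      push_cast
      field_simp
      ring
    rw [this, Real.exp_zero, mul_one]
  have h5 : (a : ℝ) ^ (2 * r) * ((D - 1 : ℕ) : ℝ) ^ (2 * r * a * D) < (D : ℝ) ^ (2 * r * a * D) := by
    rw [← h4]
    refine lt_of_le_of_lt (mul_le_mul_of_nonneg_left h3 (by positivity)) ?_
    exact mul_lt_mul_of_pos_right h1 (by positivity)
  exact_mod_cast h5

/-- The cost of one halving of the rank. -/
noncomputable def stepCount (Δ r : ℕ) : ℕ := 2 * r * (Δ + 1) * rectangleDensityInv Δ r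

/-- The main term is `(2 * Δ + 1) * roundingCount Δ r * log 4`, below `360 * Δ ^ 3 * √r * log r`;
the rest of `600` absorbs lower-order terms. -/
theorem log_two_mul_stepCount_le {Δ r : ℕ} (hΔ : 0 < Δ) (hr : 2 ≤ r) :
    Real.log (2 * stepCount Δ r) ≤ 600 * (Δ : ℝ) ^ 3 * (√r * Real.log r) := by
  have hΔ1 : (1 : ℝ) ≤ Δ := by exact_mod_cast hΔ
  have hr2 : (2 : ℝ) ≤ r := by exact_mod_cast hr
  have hl2 := Real.log_two_gt_d9
  have hl2' := Real.log_two_lt_d9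
  have hsr : 1 ≤ √r := Real.one_le_sqrt.2 (by linarith)
  have hlr : Real.log 2 ≤ Real.log r := Real.log_le_log (by norm_num) hr2
  set l := Real.log r with hl
  set X := √r * l with hX
  have hlX : l ≤ X := le_mul_of_one_le_left (by linarith) hsr
  have hlog8 : Real.log 8 = 3 * Real.log 2 := by
    rw [show (8 : ℝ) = 2 ^ 3 by norm_num, Real.log_pow]
    norm_num
  have hlog4 : Real.log 4 = 2 * Real.log 2 := by
    rw [show (4 : ℝ) = 2 ^ 2 by norm_num, Real.log_pow]
    norm_num
  have hlogΔ : Real.log Δ ≤ Δ := Real.log_le_self (by linarith)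
  have hlogΔ1 : Real.log (Δ + 1) ≤ Δ := by
    have := Real.log_le_sub_one_of_pos (show (0 : ℝ) < Δ + 1 by linarith)
    linarith
  have hlog : Real.log (8 * r * Δ) ≤ 6 * Δ * l := by
    rw [Real.log_mul (by positivity) (by positivity), Real.log_mul (by norm_num) (by positivity),
      hlog8]
    nlinarith
  have hT : (roundingCount Δ r : ℝ) ≤ 86 * (Δ : ℝ) ^ 2 * X := by
    have h1 : (roundingCount Δ r : ℝ) < 14 * Δ * √r * Real.log (8 * r * Δ) + 1 := by
      refine Nat.ceil_lt_add_one ?_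
      have := (Real.log_pos (one_lt_eight_mul hΔ (by omega : 0 < r))).le
      positivity
    have h2 : 14 * Δ * √r * Real.log (8 * r * Δ) ≤ 14 * Δ * √r * (6 * Δ * l) :=
      mul_le_mul_of_nonneg_left hlog (by positivity)
    have h3 : 14 * Δ * √r * (6 * Δ * l) = 84 * (Δ : ℝ) ^ 2 * X := by rw [hX]; ring
    have h4 : 1 ≤ 2 * (Δ : ℝ) ^ 2 * X := by
      have : (1 : ℝ) ≤ (Δ : ℝ) ^ 2 := one_le_pow₀ hΔ1
      nlinarith
    linarith
  have hX0 : 1 / 2 ≤ X := by linarith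
  have hexp : Real.log (2 * stepCount Δ r) = Real.log 2 * 5 + l + 2 * Real.log (Δ + 1) +
      (2 * Δ + 1) * roundingCount Δ r * (2 * Real.log 2) := by
    have e : (2 * stepCount Δ r : ℝ) =
        2 ^ 5 * r * (Δ + 1) ^ 2 * 4 ^ ((2 * Δ + 1) * roundingCount Δ r) := by
      simp only [stepCount, rectangleDensityInv]
      push_cast
      ring
    rw [e, Real.log_mul (by positivity) (by positivity), Real.log_mul (by positivity) (by positivity),
      Real.log_mul (by positivity) (by positivity), Real.log_pow, Real.log_pow, Real.log_pow, hlog4]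
    push_cast
    ring
  rw [hexp]
  have h1 : (2 * (Δ : ℝ) + 1) * roundingCount Δ r ≤ 258 * (Δ : ℝ) ^ 3 * X := by
    calc (2 * (Δ : ℝ) + 1) * roundingCount Δ r ≤ (3 * Δ) * (86 * (Δ : ℝ) ^ 2 * X) := by
          gcongr
          linarith
      _ = _ := by ring
  have hY : 0 ≤ (2 * (Δ : ℝ) + 1) * roundingCount Δ r := by positivity
  have h2 : (Δ : ℝ) ≤ (Δ : ℝ) ^ 3 := le_self_pow₀ hΔ1 (by norm_num)
  have h3 : (Δ : ℝ) ≤ 2 * ((Δ : ℝ) ^ 3 * X) := by nlinarith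
  have h4 : X ≤ (Δ : ℝ) ^ 3 * X := le_mul_of_one_le_left (by linarith) (hΔ1.trans h2)
  nlinarith

/-- The logarithm of the bound on the nonnegative rank. -/
noncomputable def logNonnegRankBound (Δ r : ℕ) : ℝ := 5000 * (Δ : ℝ) ^ 3 * (√r * Real.log r)

theorem nonnegRankBound_floor_exp {Δ : ℕ} (hΔ : 0 < Δ) (r : ℕ) :
    NonnegRankBound Δ r ⌊Real.exp (logNonnegRankBound Δ r)⌋₊ := by
  induction r using Nat.strong_induction_on with
  | _ r ih =>
    rcases Nat.lt_or_ge r 2 with hr | hr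
    -- For `r = 0` and `r = 1` the exponent vanishes, so the claimed bound is exactly `1`.
    · have h0 : logNonnegRankBound Δ r = 0 := by
        interval_cases r <;> simp [logNonnegRankBound]
      rw [h0, Real.exp_zero, Nat.floor_one]
      exact nonnegRankBound_of_rank_le_one (by omega)
    · have hD : 0 < rectangleDensityInv Δ r := by
        unfold rectangleDensityInv
        positivity
      have hstep := nonnegRankBound_step hD (rectangleBound_rectangleDensityInv hΔ hr)
        (ih ((r + 1) / 2) (by omega)) (pow_mul_pow_lt_pow (a := Δ + 1) (by omega : 0 < r) hD)
      set h := (r + 1) / 2 with hh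
      have hh1 : 1 ≤ h := by omega
      have hΔ1 : (1 : ℝ) ≤ Δ := by exact_mod_cast hΔ
      have hr2 : (2 : ℝ) ≤ r := by exact_mod_cast hr
      have hle : stepCount Δ r * (1 + ⌊Real.exp (logNonnegRankBound Δ h)⌋₊) ≤
          ⌊Real.exp (logNonnegRankBound Δ r)⌋₊ := by
        refine Nat.le_floor ?_
        have hspos : 0 < stepCount Δ r := by
          unfold stepCount
          positivity
        have hspos' : (0 : ℝ) < stepCount Δ r := by exact_mod_cast hspos
        have hlogh : 0 ≤ Real.log h := Real.log_natCast_nonneg h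
        have h1 : 1 ≤ Real.exp (logNonnegRankBound Δ h) := by
          refine Real.one_le_exp ?_
          unfold logNonnegRankBound
          positivity
        have h2 : (⌊Real.exp (logNonnegRankBound Δ h)⌋₊ : ℝ) ≤ Real.exp (logNonnegRankBound Δ h) :=
          Nat.floor_le (Real.exp_pos _).le
        have h3 : (2 * stepCount Δ r : ℝ) ≤ Real.exp (600 * (Δ : ℝ) ^ 3 * (√r * Real.log r)) := by
          rw [← Real.log_le_iff_le_exp (by positivity)]
          exact log_two_mul_stepCount_le hΔ hr
        -- Rounding up still gives `h ≤ 3 / 4 * r`, and `√(3 / 4) < 7 / 8`. The induction then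
        -- closes because `600 + 7 / 8 * 5000 ≤ 5000`.
        have h4 : √h * Real.log h ≤ 7 / 8 * (√r * Real.log r) := by
          have e1 : (h : ℝ) ≤ 3 / 4 * r := by
            have : 4 * h ≤ 3 * r := by omega
            have : (4 * h : ℝ) ≤ 3 * r := by exact_mod_cast this
            linarith
          have e2 : √h ≤ 7 / 8 * √r := by
            rw [Real.sqrt_le_left (by positivity), mul_pow, Real.sq_sqrt (by positivity)]
            linarith
          have e3 : Real.log h ≤ Real.log r :=
            Real.log_le_log (by exact_mod_cast hh1) (by linarith)
          calc √h * Real.log h ≤ (7 / 8 * √r) * Real.log r :=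
                mul_le_mul e2 e3 hlogh (by positivity)
            _ = _ := by ring
        push_cast
        calc (stepCount Δ r : ℝ) * (1 + ⌊Real.exp (logNonnegRankBound Δ h)⌋₊)
            ≤ stepCount Δ r * (2 * Real.exp (logNonnegRankBound Δ h)) := by
              gcongr
              linarith
          _ = (2 * stepCount Δ r) * Real.exp (logNonnegRankBound Δ h) := by ring
          _ ≤ Real.exp (600 * (Δ : ℝ) ^ 3 * (√r * Real.log r)) *
              Real.exp (logNonnegRankBound Δ h) := by gcongr
          _ = Real.exp (600 * (Δ : ℝ) ^ 3 * (√r * Real.log r) + logNonnegRankBound Δ h) :=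
              (Real.exp_add _ _).symm
          _ ≤ _ := by
              refine Real.exp_le_exp.2 ?_
              have h5 : (0 : ℝ) ≤ (Δ : ℝ) ^ 3 := by positivity
              have h6 := mul_le_mul_of_nonneg_left h4 h5
              have h7 : 0 ≤ (Δ : ℝ) ^ 3 * (√r * Real.log r) := by
                have := Real.log_natCast_nonneg r
                positivity
              unfold logNonnegRankBound
              nlinarith
      intro I J _ _ A hA hrank
      exact (hstep I J A hA hrank).mono hle

theorem logNonnegRankBound_succ_le {Δ n : ℕ} (hΔ : 0 < Δ) (hn : 2 ≤ n) :
    logNonnegRankBound Δ (n + 1) ≤ ((max Δ 2 : ℕ) : ℝ) ^ (20 * Δ) * √n * Real.log n := by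
  have hn2 : (2 : ℝ) ≤ n := by exact_mod_cast hn
  have hlog : 0 ≤ Real.log n := Real.log_natCast_nonneg n
  have h1 : √((n + 1 : ℕ) : ℝ) ≤ 2 * √n := by
    rw [Real.sqrt_le_left (by positivity), mul_pow, Real.sq_sqrt (by positivity)]
    push_cast
    linarith
  have h2 : Real.log ((n + 1 : ℕ) : ℝ) ≤ 2 * Real.log n := by
    have : 2 * Real.log n = Real.log ((n : ℝ) ^ 2) := by rw [Real.log_pow]; norm_num
    rw [this]
    refine Real.log_le_log (by positivity) ?_
    push_cast
    nlinarith
  have h3 : √((n + 1 : ℕ) : ℝ) * Real.log ((n + 1 : ℕ) : ℝ) ≤ 4 * (√n * Real.log n) := by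
    calc _ ≤ (2 * √n) * (2 * Real.log n) :=
          mul_le_mul h1 h2 (Real.log_natCast_nonneg _) (by positivity)
      _ = _ := by ring
  -- Source of the constant `20`: seventeen factors `2` cover `20000` and three factors cover `Δ ^
  -- 3`.
  have h4 : 20000 * (Δ : ℝ) ^ 3 ≤ ((max Δ 2 : ℕ) : ℝ) ^ (20 * Δ) := by
    set m := max Δ 2 with hm
    have hm2 : 2 ≤ m := le_max_right _ _
    have hmΔ : Δ ≤ m := le_max_left _ _
    have : 20000 * Δ ^ 3 ≤ m ^ (20 * Δ) := by
      calc 20000 * Δ ^ 3 ≤ 2 ^ 17 * m ^ 3 := Nat.mul_le_mul (by norm_num) (Nat.pow_le_pow_left hmΔ 3)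
        _ ≤ m ^ 17 * m ^ 3 := Nat.mul_le_mul_right _ (Nat.pow_le_pow_left hm2 17)
        _ = m ^ 20 := by ring
        _ ≤ m ^ (20 * Δ) := Nat.pow_le_pow_right (by omega) (by omega)
    exact_mod_cast this
  calc logNonnegRankBound Δ (n + 1)
      ≤ 5000 * (Δ : ℝ) ^ 3 * (4 * (√n * Real.log n)) := by
        unfold logNonnegRankBound
        exact mul_le_mul_of_nonneg_left h3 (by positivity)
    _ = 20000 * (Δ : ℝ) ^ 3 * (√n * Real.log n) := by ring
    _ ≤ ((max Δ 2 : ℕ) : ℝ) ^ (20 * Δ) * (√n * Real.log n) :=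
        mul_le_mul_of_nonneg_right h4 (by positivity)
    _ = _ := by ring

/-! ### Slack matrices -/

section SlackMatrix

variable {d : ℕ} {P : Set (Fin d → ℝ)}
  {S : Matrix {F : Set (Fin d → ℝ) // IsFacet P F} (P.extremePoints ℝ) ℝ}

/-- A facet is determined by its row in a slack matrix. -/
theorem IsSlackMatrix.row_injective (hS : IsSlackMatrix P S) (hP : IsPolytope P) :
    Function.Injective S.row := by
  obtain ⟨a, b, hface, hSab⟩ := hS
  intro f g hfg
  have hv : ∀ v ∈ P.extremePoints ℝ, (a f - a g) ⬝ᵥ v = b f - b g := fun v hv => by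
    have h1 : S f ⟨v, hv⟩ = S g ⟨v, hv⟩ := congrFun hfg ⟨v, hv⟩
    rw [hSab, hSab] at h1
    rw [sub_dotProduct]
    linarith
  have hle := hP.forall_le_of_extremePoints fun v h => (hv v h).le
  have hge := hP.forall_le_of_extremePoints (a := -(a f - a g)) (b := -(b f - b g))
    fun v h => by simp only [neg_dotProduct, hv v h, le_refl]
  ext x
  rw [(hface f).2, (hface g).2]
  refine and_congr_right fun hx => ?_
  have h1 := hle x hx
  have h2 := hge x hx
  rw [neg_dotProduct] at h2
  rw [sub_dotProduct] at h1 h2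
  constructor <;> intro h <;> linarith

/-- Slacks are affine functions on the affine hull, described by a constant term and `affDim P`
linear coordinates. -/
theorem IsSlackMatrix.rank_le [Fintype {F : Set (Fin d → ℝ) // IsFacet P F}]
    [Fintype (P.extremePoints ℝ)] (hS : IsSlackMatrix P S) (hne : P.Nonempty) :
    S.rank ≤ affDim P + 1 := by
  obtain ⟨a, b, hface, hSab⟩ := hS
  obtain ⟨p, hp⟩ := hne
  let e := Module.finBasisOfFinrankEq ℝ (vectorSpan ℝ P) (rfl : _ = affDim P)
  have hmem : ∀ v : P.extremePoints ℝ, v.1 - p ∈ vectorSpan ℝ P := fun v =>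
    vsub_mem_vectorSpan ℝ v.2.1 hp
  let U : Matrix {F : Set (Fin d → ℝ) // IsFacet P F} (Fin (affDim P + 1)) ℝ :=
    Matrix.of fun f => Fin.cons (b f - a f ⬝ᵥ p) fun k => -(a f ⬝ᵥ (e k).1)
  let W : Matrix (Fin (affDim P + 1)) (P.extremePoints ℝ) ℝ :=
    Matrix.of fun k v => Fin.cons (α := fun _ => ℝ) 1 (fun k => e.repr ⟨v.1 - p, hmem v⟩ k) k
  have hUW : S = U * W := by
    ext f v
    have h1 := congrArg Subtype.val (e.sum_repr ⟨v.1 - p, hmem v⟩)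
    simp only [Submodule.coe_sum, Submodule.coe_smul] at h1
    have h2 : a f ⬝ᵥ v.1 = a f ⬝ᵥ p + a f ⬝ᵥ (v.1 - p) := by
      rw [dotProduct_sub]
      ring
    rw [hSab, h2, ← h1, dotProduct_sum, Matrix.mul_apply, Fin.sum_univ_succ]
    simp only [U, W, Matrix.of_apply, Fin.cons_zero, Fin.cons_succ, dotProduct_smul, smul_eq_mul,
      neg_mul, Finset.sum_neg_distrib, mul_one]
    have h3 : ∀ k, e.repr ⟨v.1 - p, hmem v⟩ k * (a f ⬝ᵥ (e k).1) =
      a f ⬝ᵥ (e k).1 * e.repr ⟨v.1 - p, hmem v⟩ k := fun k => mul_comm _ _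
    simp only [h3]
    ring
  rw [hUW]
  exact (Matrix.rank_mul_le_left U W).trans (by simpa using U.rank_le_card_width)

end SlackMatrix

/-! ### The main theorem. -/

theorem mainTheorem2 :
    ∃ C : ℕ, ∀ (Δ n d : ℕ) (P : Set (Fin d → ℝ)),
      2 ≤ n → IsPolytope P → affDim P = n →
      ∀ S : Matrix {F : Set (Fin d → ℝ) // IsFacet P F} (P.extremePoints ℝ) ℝ,
        IsSlackMatrix P S →
        (∀ f v, ∃ k : ℕ, k ≤ Δ ∧ S f v = (k : ℝ)) →
        ((extensionComplexity P : ℕ∞) : ENNReal) ≤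
          ENNReal.ofReal
            (Real.exp (((max Δ 2 : ℕ) : ℝ) ^ (C * Δ) * Real.sqrt (n : ℝ) * Real.log (n : ℝ))) := by
  refine ⟨20, fun Δ n d P hn hP hdim S hS hSΔ => ?_⟩
  have hPne : P.Nonempty := by
    rw [Set.nonempty_iff_ne_empty]
    rintro rfl
    rw [affDim, vectorSpan_empty, finrank_bot] at hdim
    omega
  choose A hA hSA using hSΔ
  have hSA' : S = Matrix.map A (Nat.cast : ℕ → ℝ) := by
    ext f v
    exact hSA f v
  obtain ⟨N, hNrank, hN⟩ : ∃ N : ℕ, NonnegRankLE S N ∧ (N : ℝ) ≤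
      Real.exp (((max Δ 2 : ℕ) : ℝ) ^ (20 * Δ) * Real.sqrt (n : ℝ) * Real.log (n : ℝ)) := by
    rcases Nat.eq_zero_or_pos Δ with rfl | hΔ
    -- For `Δ = 0` the slack matrix is zero, an empty sum.
    · refine ⟨0, ⟨fun _ _ => 0, fun _ _ => 0, fun _ _ => le_rfl, fun _ _ => le_rfl,
        fun f v => ?_⟩, by simpa using (Real.exp_pos _).le⟩
      simp [hSA, Nat.le_zero.1 (hA f v)]
    · have := hP.finite_extremePoints.fintype
      -- Facets inject into their rows, which are functions from the finite vertex set to `Fin (Δ +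
      -- 1)`.
      have : Finite {F : Set (Fin d → ℝ) // IsFacet P F} := by
        refine Finite.of_injective
          (fun f (v : P.extremePoints ℝ) => (⟨A f v, Nat.lt_succ_iff.2 (hA f v)⟩ : Fin (Δ + 1)))
          fun f g hfg => hS.row_injective hP ?_
        ext v
        have h1 : A f v = A g v := congrArg Fin.val (congrFun hfg v)
        simp [hSA, h1]
      have := Fintype.ofFinite {F : Set (Fin d → ℝ) // IsFacet P F}
      have hrank := hS.rank_le hPne
      rw [hdim, hSA'] at hrank
      refine ⟨_, hSA' ▸ nonnegRankBound_floor_exp hΔ (n + 1) _ _ A hA hrank, ?_⟩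
      exact (Nat.floor_le (Real.exp_pos _).le).trans
        (Real.exp_le_exp.2 (logNonnegRankBound_succ_le hΔ hn))
  have hxc := extensionComplexity_le_of_nonnegRankLE hP hPne hS hNrank
  calc ((extensionComplexity P : ℕ∞) : ENNReal) ≤ ((N : ℕ∞) : ENNReal) := by exact_mod_cast hxc
    _ = ENNReal.ofReal N := by simp
    _ ≤ _ := ENNReal.ofReal_le_ofReal hN
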